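/- Fix $0<q<1$. **Algebras.** Let $\mathcal A(SU_q(2))$ be the unital $*$-algebra over $\mathbb C$ generated by $a,c$ with relations $$ac=q\,ca,\quad ac^*=q\,c^*a,\quad cc^*=c^*c,\quad a^*a+c^*c=1,\quad aa^*+q^2cc^*=1,$$ (and their adjoints), with coproduct $\Delta a=a\otimes a-q\,c^*\otimes c$, $\Delta c=c\otimes a+a^*\otimes c$ extended as a $*$-homomorphism. Let $\mathcal U_q(su(2))$ be the algebra generated by $K,K^{-1},E,F$ with $KK^{-1}=K^{-1}K=1$, $K^{\pm1}E=q^{\pm1}EK^{\pm1}$, $K^{\pm1}F=q^{\mp1}FK^{\pm1}$, $[E,F]=(K^2-K^{-2})/(q-q^{-1})$. It acts on $\mathcal A(SU_q(2))$ on the left by $h\triangleright x=x_{(1)}\langle h,x_{(2)}\rangle$, where $\langle K^{\pm1},\cdot\rangle$ are the characters and $\langle E,\cdot\rangle,\langle F,\cdot\rangle$ the functionals satisfying $\langle X,xy\rangle=\langle X,x\rangle\langle K,y\rangle+\langle K^{-1},x\rangle\langle X,y\rangle$ for $X=E,F$, whose non-zero values on $a,a^*,c,c^*$ are $$\langle K^{\pm1},a\rangle=q^{\mp1/2},\quad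 \langle K^{\pm1},a^*\rangle=q^{\pm1/2},\quad \langle E,c\rangle=1,\quad \langle F,c^*\rangle=-q^{-1}.$$ Put $X_+=q^{1/2}EK$, $X_-=q^{-1/2}FK$ and $X_z=(1-K^4)/(1-q^{-2})$. For $n\in\mathbb Z$ put $\mathcal L_n=\{x\in\mathcal A(SU_q(2)):K\triangleright x=q^{n/2}x\}$. The algebra $\mathcal A(S_q^2)$ is the algebra of coinvariants for the right coaction $(\mathrm{id}\otimes\pi)\Delta$ of $\mathcal A(U(1))=\mathbb C[z,z^{-1}]$, where $\pi(a)=z$, $\pi(a^*)=z^{-1}$, $\pi(c)=\pi(c^*)=0$; it equals $\mathcal L_0$, and each $\mathcal L_n$ is an $\mathcal A(S_q^2)$-bimodule. **Calculus.** The two-dimensional calculus on the sphere is $$\Omega^\bullet(S_q^2)=\mathcal A(S_q^2)\oplus(\mathcal L_{-2}\,\omega_-\oplus\mathcal L_{2}\,\omega_+)\oplus\mathcal A(S_q^2)\,\omega_+\wedge\omega_-,$$ where $\omega_\pm$ and $\omega_+\wedge\omega_-$ commute with $\mathcal A(S_q^2)$, $(x\omega_-+y\omega_+)\wedge(t\omega_-+z\omega_+)=(q^{-2}yt-xz)\,\omega_+\wedge\omega_-$,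 $\mathrm df=(X_-\triangleright f)\omega_-+(X_+\triangleright f)\omega_+$ for $f\in\mathcal A(S_q^2)$, and $\mathrm d(x\omega_-+y\omega_+)=(X_+\triangleright x-q^{-2}X_-\triangleright y)\,\omega_+\wedge\omega_-$. The Hodge operator $\star$ is the $\mathcal A(S_q^2)$-bimodule map with $\star(x\omega_-+y\omega_+)=-x\omega_-+y\omega_+$ and $\star(\omega_+\wedge\omega_-)=1$, $\star 1=\omega_+\wedge\omega_-$. **Gauged Laplacian.** A covariant derivative on a left $\mathcal A(S_q^2)$-module $\mathcal E$ is a linear map $\nabla:\mathcal E\to\Omega^1(S_q^2)\otimes_{\mathcal A(S_q^2)}\mathcal E$ with $\nabla(f\phi)=f\nabla\phi+\mathrm df\otimes\phi$. It is extended to $\Omega^1(S_q^2)\otimes_{\mathcal A(S_q^2)}\mathcal E$ by $\nabla(\alpha\otimes\phi)=\mathrm d\alpha\otimes\phi-\alpha\wedge\nabla\phi$, the operator $\star$ acts as $\star\otimes\mathrm{id}$ (with $\mathcal A(S_q^2)\otimes_{\mathcal A(S_q^2)}\mathcal E=\mathcal E$), and the gauged Laplacian is $$\Box_\nabla=-\tfrac12\star\nabla\star\nabla:\mathcal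 E\to\mathcal E.$$ **The connection on $\mathcal L_n$.** Multiplication, with $\omega_\pm\phi=(K^2\triangleright\phi)\,\omega_\pm$, gives an isomorphism $\Omega^1(S_q^2)\otimes_{\mathcal A(S_q^2)}\mathcal L_n\simeq\mathcal L_{n-2}\,\omega_-\oplus\mathcal L_{n+2}\,\omega_+$. On $\mathcal L_n$ take the covariant derivative that under this isomorphism is $\nabla\phi=(\mathrm{id}-\Pi_z)\mathrm d\phi=(X_+\triangleright\phi)\omega_++(X_-\triangleright\phi)\omega_-$; here $\mathrm d\phi=(X_-\triangleright\phi)\omega_-+(X_+\triangleright\phi)\omega_++(X_z\triangleright\phi)\omega_z$ in the three-dimensional calculus on $SU_q(2)$, with left basis $\omega_-,\omega_+,\omega_z$, and $\Pi_z(\omega_z)=\omega_z$, $\Pi_z(\omega_\pm)=0$. **The connection on $\mathcal E_n$.** For $0\le\mu\le|n|$ put $$|\Psi^{(n)}\rangle_\mu=\sqrt{\beta_{n,\mu}}\;c^{*\mu}a^{*\,n-\mu}\ \ (n\ge0),\qquad |\Psi^{(n)}\rangle_\mu=\sqrt{\alpha_{n,\mu}}\;c^{|n|-\mu}a^{\mu}\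 \ (n\le0),$$ $$\beta_{n,\mu}=q^{2\mu}\prod_{j=0}^{\mu-1}\frac{1-q^{-2(n-j)}}{1-q^{-2(j+1)}},\qquad \alpha_{n,\mu}=\prod_{j=0}^{|n|-\mu-1}\frac{1-q^{2(|n|-j)}}{1-q^{2(j+1)}},$$ and let $\langle\Psi^{(n)}|$ be the row with entries $(|\Psi^{(n)}\rangle_\mu)^*$. Then $\langle\Psi^{(n)}|\Psi^{(n)}\rangle=1$ and $p^{(n)}=|\Psi^{(n)}\rangle\langle\Psi^{(n)}|$ is a projection with entries in $\mathcal A(S_q^2)$. Let $\mathcal E_n=\mathcal A(S_q^2)^{|n|+1}p^{(n)}$, with the Grassmann connection $\nabla\sigma=(\mathrm d\sigma)\,p^{(n)}$, and let $\phi\mapsto\sigma_\phi=\phi\,\langle\Psi^{(n)}|$, which is an isomorphism of left $\mathcal A(S_q^2)$-modules $\mathcal L_n\simeq\mathcal E_n$. **Proposition.** For every $n\in\mathbb Z$ and every $\phi\in\mathcal L_n$: 1. for the above connection on $\mathcal L_n$, $$\Box_\nabla\phi=\tfrac12\,q^{-2n}\,(X_+X_-+q^{-2}X_-X_+)\triangleright\phi;$$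 2. the gauged Laplacian of the Grassmann connection on $\mathcal E_n$ corresponds to that of $\mathcal L_n$: $$\Box_\nabla(\sigma_\phi)=\sigma_{\Box_\nabla\phi}.$$ -/

import Mathlib

open scoped TensorProduct

noncomputable section

namespace QHopf

/-! Scalars -/

/-- The deformation parameter `q` as a complex number. -/
def qC (q : Set.Ioo (0 : ℝ) 1) : ℂ := ((q : ℝ) : ℂ)

/-- The complex number `q ^ (1/2)`; its integer powers are the numbers `q ^ (n/2)`. -/
def qH (q : Set.Ioo (0 : ℝ) 1) : ℂ := ((Real.sqrt (q : ℝ) : ℝ) : ℂ)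

variable (q : Set.Ioo (0 : ℝ) 1)

theorem qH_mul_self : qH q * qH q = qC q := by
  rw [qH, qC, ← Complex.ofReal_mul, Real.mul_self_sqrt q.2.1.le]

theorem qC_eq : qC q = qH q ^ 2 := by rw [sq, qH_mul_self]

theorem qC_ne : qC q ≠ 0 := by
  have := q.2.1.ne'
  simpa [qC] using this

theorem qH_ne : qH q ≠ 0 := by
  intro h
  apply qC_ne q
  rw [qC_eq, h]; simp

theorem qH_pos : 0 < Real.sqrt (q : ℝ) := Real.sqrt_pos.2 q.2.1

theorem qH_lt : Real.sqrt (q : ℝ) < 1 := by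
  rw [Real.sqrt_lt' one_pos]; simpa using q.2.2

theorem qH_zpow_inj {m n : ℤ} (h : qH q ^ m = qH q ^ n) : m = n := by
  simp only [qH, ← Complex.ofReal_zpow, Complex.ofReal_inj] at h
  exact zpow_right_injective₀ (qH_pos q) (qH_lt q).ne h

theorem qC_sub_ne : qC q - (qC q)⁻¹ ≠ 0 := by
  intro h
  have h1 : qC q = (qC q)⁻¹ := sub_eq_zero.1 h
  have h2 : qC q ^ 2 = 1 := by
    rw [sq]; nth_rw 2 [h1]; exact mul_inv_cancel₀ (qC_ne q)
  have h3 : ((q : ℝ)) ^ 2 = 1 := by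
    have : (((q : ℝ) ^ 2 : ℝ) : ℂ) = ((1 : ℝ) : ℂ) := by simpa [qC] using h2
    exact_mod_cast this
  nlinarith [q.2.1, q.2.2]

/-! The coordinate algebra of the quantum group `SU_q(2)` -/

/-- Generators `a, a*, c, c*` of the coordinate algebra. -/
inductive Gen
  | a | as | c | cs

/-- The defining relations together with their adjoints. -/
inductive Rel : FreeAlgebra ℂ Gen → FreeAlgebra ℂ Gen → Prop
  | ac : Rel (FreeAlgebra.ι ℂ Gen.a * FreeAlgebra.ι ℂ Gen.c)
      (qC q • (FreeAlgebra.ι ℂ Gen.c * FreeAlgebra.ι ℂ Gen.a))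
  | acs : Rel (FreeAlgebra.ι ℂ Gen.a * FreeAlgebra.ι ℂ Gen.cs)
      (qC q • (FreeAlgebra.ι ℂ Gen.cs * FreeAlgebra.ι ℂ Gen.a))
  | csas : Rel (FreeAlgebra.ι ℂ Gen.cs * FreeAlgebra.ι ℂ Gen.as)
      (qC q • (FreeAlgebra.ι ℂ Gen.as * FreeAlgebra.ι ℂ Gen.cs))
  | cas : Rel (FreeAlgebra.ι ℂ Gen.c * FreeAlgebra.ι ℂ Gen.as)
      (qC q • (FreeAlgebra.ι ℂ Gen.as * FreeAlgebra.ι ℂ Gen.c))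
  | ccs : Rel (FreeAlgebra.ι ℂ Gen.c * FreeAlgebra.ι ℂ Gen.cs)
      (FreeAlgebra.ι ℂ Gen.cs * FreeAlgebra.ι ℂ Gen.c)
  | asa : Rel (FreeAlgebra.ι ℂ Gen.as * FreeAlgebra.ι ℂ Gen.a +
      FreeAlgebra.ι ℂ Gen.cs * FreeAlgebra.ι ℂ Gen.c) 1
  | aas : Rel (FreeAlgebra.ι ℂ Gen.a * FreeAlgebra.ι ℂ Gen.as +
      qC q ^ 2 • (FreeAlgebra.ι ℂ Gen.c * FreeAlgebra.ι ℂ Gen.cs)) 1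

/-- The coordinate algebra `A(SU_q(2))`. -/
def A : Type := RingQuot (Rel q)

instance : Ring (A q) := inferInstanceAs (Ring (RingQuot (Rel q)))
instance : Algebra ℂ (A q) := inferInstanceAs (Algebra ℂ (RingQuot (Rel q)))

/-- The quotient map. -/
def mkA : FreeAlgebra ℂ Gen →ₐ[ℂ] A q := RingQuot.mkAlgHom ℂ (Rel q)

theorem mkA_rel {x y : FreeAlgebra ℂ Gen} (h : Rel q x y) : mkA q x = mkA q y :=
  RingQuot.mkAlgHom_rel ℂ h

/-- The class of a generator. -/
def gen (g : Gen) : A q := mkA q (FreeAlgebra.ι ℂ g)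

/-- The generator `a`. -/
def ga : A q := gen q Gen.a
/-- The generator `c`. -/
def gc : A q := gen q Gen.c
/-- The generator `a*`. -/
def gas : A q := gen q Gen.as
/-- The generator `c*`. -/
def gcs : A q := gen q Gen.cs

/-- Four elements of an algebra satisfying the defining relations. -/
structure IsRep {B : Type} [Ring B] [Algebra ℂ B] (a as c cs : B) : Prop where
  ac : a * c = qC q • (c * a)
  acs : a * cs = qC q • (cs * a)
  csas : cs * as = qC q • (as * cs)
  cas : c * as = qC q • (as * c)
  ccs : c * cs = cs * c
  asa : as * a + cs * c = 1
  aas : a * as + qC q ^ 2 • (c * cs) = 1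

theorem isRep_gen : IsRep q (ga q) (gas q) (gc q) (gcs q) := by
  constructor
  · simpa only [map_mul, map_add, map_smul, map_one, ga, gas, gc, gcs, gen] using mkA_rel q Rel.ac
  · simpa only [map_mul, map_add, map_smul, map_one, ga, gas, gc, gcs, gen] using mkA_rel q Rel.acs
  · simpa only [map_mul, map_add, map_smul, map_one, ga, gas, gc, gcs, gen] using mkA_rel q Rel.csas
  · simpa only [map_mul, map_add, map_smul, map_one, ga, gas, gc, gcs, gen] using mkA_rel q Rel.cas
  · simpa only [map_mul, map_add, map_smul, map_one, ga, gas, gc, gcs, gen] using mkA_rel q Rel.ccs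
  · simpa only [map_mul, map_add, map_smul, map_one, ga, gas, gc, gcs, gen] using mkA_rel q Rel.asa
  · simpa only [map_mul, map_add, map_smul, map_one, ga, gas, gc, gcs, gen] using mkA_rel q Rel.aas

/-- Assignment of values to the four generators. -/
def genVal {B : Type} (a as c cs : B) : Gen → B
  | Gen.a => a
  | Gen.as => as
  | Gen.c => c
  | Gen.cs => cs

variable {q}

/-- The universal property of `A(SU_q(2))`. -/
def liftA {B : Type} [Ring B] [Algebra ℂ B] {a as c cs : B} (h : IsRep q a as c cs) :
    A q →ₐ[ℂ] B :=
  RingQuot.liftAlgHom ℂ ⟨FreeAlgebra.lift ℂ (genVal a as c cs), by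
    intro x y hxy
    cases hxy
    · simpa [genVal] using h.ac
    · simpa [genVal] using h.acs
    · simpa [genVal] using h.csas
    · simpa [genVal] using h.cas
    · simpa [genVal] using h.ccs
    · simpa [genVal] using h.asa
    · simpa [genVal] using h.aas⟩

section lift
variable {B : Type} [Ring B] [Algebra ℂ B] {a as c cs : B} (h : IsRep q a as c cs)

theorem liftA_gen (g : Gen) : liftA h (gen q g) = genVal a as c cs g := by
  unfold liftA gen mkA
  erw [RingQuot.liftAlgHom_mkAlgHom_apply]
  simp

@[simp] theorem liftA_a : liftA h (ga q) = a := liftA_gen h _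
@[simp] theorem liftA_as : liftA h (gas q) = as := liftA_gen h _
@[simp] theorem liftA_c : liftA h (gc q) = c := liftA_gen h _
@[simp] theorem liftA_cs : liftA h (gcs q) = cs := liftA_gen h _

end lift

theorem algHom_extA {B : Type} [Ring B] [Algebra ℂ B] {f g : A q →ₐ[ℂ] B}
    (h1 : f (ga q) = g (ga q)) (h2 : f (gas q) = g (gas q))
    (h3 : f (gc q) = g (gc q)) (h4 : f (gcs q) = g (gcs q)) : f = g := by
  apply RingQuot.ringQuot_ext'
  apply FreeAlgebra.hom_ext
  funext x
  cases x
  · exact h1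
  · exact h2
  · exact h3
  · exact h4

theorem adjoin_gens : Algebra.adjoin ℂ {ga q, gas q, gc q, gcs q} = ⊤ := by
  set S := Algebra.adjoin ℂ ({ga q, gas q, gc q, gcs q} : Set (A q)) with hS
  have m (x : A q) (hx : x ∈ ({ga q, gas q, gc q, gcs q} : Set (A q))) : x ∈ S :=
    Algebra.subset_adjoin hx
  have r := isRep_gen q
  have h : IsRep q (⟨ga q, m _ (by simp)⟩ : S) ⟨gas q, m _ (by simp)⟩ ⟨gc q, m _ (by simp)⟩
      ⟨gcs q, m _ (by simp)⟩ :=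
    ⟨Subtype.ext r.ac, Subtype.ext r.acs, Subtype.ext r.csas, Subtype.ext r.cas,
      Subtype.ext r.ccs, Subtype.ext r.asa, Subtype.ext r.aas⟩
  have e : S.val.comp (liftA h) = AlgHom.id ℂ (A q) := by
    apply algHom_extA <;> simp
  refine eq_top_iff.2 fun x _ => ?_
  have := congrArg (fun f => f x) e
  simp only [AlgHom.comp_apply, AlgHom.id_apply] at this
  rw [← this]
  exact (liftA h x).2

theorem induct {p : A q → Prop} (x : A q) (h1 : p 1) (hs : ∀ (r : ℂ) x, p x → p (r • x))
    (hadd : ∀ x y, p x → p y → p (x + y)) (hmul : ∀ x y, p x → p y → p (x * y))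
    (ha : p (ga q)) (has : p (gas q)) (hc : p (gc q)) (hcs : p (gcs q)) : p x := by
  have hx : x ∈ Algebra.adjoin ℂ ({ga q, gas q, gc q, gcs q} : Set (A q)) := by
    rw [adjoin_gens]; trivial
  induction hx using Algebra.adjoin_induction with
  | mem x hx =>
    rcases hx with rfl | rfl | rfl | rfl <;> assumption
  | algebraMap r => rw [Algebra.algebraMap_eq_smul_one]; exact hs _ _ h1
  | add x y _ _ h1 h2 => exact hadd _ _ h1 h2
  | mul x y _ _ h1 h2 => exact hmul _ _ h1 h2

/-! Reordering rules -/

theorem r1 : ga q * gc q = qC q • (gc q * ga q) := (isRep_gen q).ac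
theorem r2 : ga q * gcs q = qC q • (gcs q * ga q) := (isRep_gen q).acs
theorem r3 : gas q * gcs q = (qC q)⁻¹ • (gcs q * gas q) := by
  rw [(isRep_gen q).csas, smul_smul, inv_mul_cancel₀ (qC_ne q), one_smul]
theorem r4 : gas q * gc q = (qC q)⁻¹ • (gc q * gas q) := by
  rw [(isRep_gen q).cas, smul_smul, inv_mul_cancel₀ (qC_ne q), one_smul]
theorem r5 : gcs q * gc q = gc q * gcs q := (isRep_gen q).ccs.symm
theorem r6 : gas q * ga q = 1 - gc q * gcs q := by
  rw [← r5]; exact eq_sub_of_add_eq (isRep_gen q).asa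
theorem r7 : ga q * gas q = 1 - qC q ^ 2 • (gc q * gcs q) :=
  eq_sub_of_add_eq (isRep_gen q).aas

/-! The star structure -/

variable (q)

/-- The opposite algebra of `A(SU_q(2))` with the complex conjugate scalar multiplication. -/
def ConjOp : Type := (A q)ᵐᵒᵖ

instance : Ring (ConjOp q) := inferInstanceAs (Ring (A q)ᵐᵒᵖ)
instance : Algebra ℂ (ConjOp q) :=
  RingHom.toAlgebra' ((algebraMap ℂ (A q)ᵐᵒᵖ).comp (starRingEnd ℂ))
    (fun c x => Algebra.commutes (starRingEnd ℂ c) (show (A q)ᵐᵒᵖ from x))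

theorem ConjOp.smul_def (r : ℂ) (x : A q) :
    r • (show ConjOp q from MulOpposite.op x) = (MulOpposite.op (star r • x) : (A q)ᵐᵒᵖ) := by
  have : r • (show ConjOp q from MulOpposite.op x) =
    (algebraMap ℂ (A q)ᵐᵒᵖ (star r)) * MulOpposite.op x := rfl
  rw [this, ← Algebra.smul_def]; rfl

theorem star_qC : star (qC q) = qC q := Complex.conj_ofReal _

theorem isRep_star : IsRep (B := ConjOp q) q (MulOpposite.op (gas q)) (MulOpposite.op (ga q))
    (MulOpposite.op (gcs q)) (MulOpposite.op (gc q)) := by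
  have r := isRep_gen q
  have hs := star_qC q
  have hs2 : star (qC q ^ 2) = qC q ^ 2 := by rw [star_pow, hs]
  constructor
  · refine Eq.trans ?_ (ConjOp.smul_def q _ _).symm
    rw [hs]; exact congrArg MulOpposite.op r.csas
  · refine Eq.trans ?_ (ConjOp.smul_def q _ _).symm
    rw [hs]; exact congrArg MulOpposite.op r.cas
  · refine Eq.trans ?_ (ConjOp.smul_def q _ _).symm
    rw [hs]; exact congrArg MulOpposite.op r.ac
  · refine Eq.trans ?_ (ConjOp.smul_def q _ _).symm
    rw [hs]; exact congrArg MulOpposite.op r.acs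
  · exact congrArg MulOpposite.op r.ccs
  · exact congrArg MulOpposite.op r.asa
  · have := ConjOp.smul_def q (qC q ^ 2) (gc q * gcs q)
    rw [hs2] at this
    exact (congrArg (fun z => (MulOpposite.op (ga q * gas q) : (A q)ᵐᵒᵖ) + z) this).trans
      (congrArg MulOpposite.op r.aas)

/-- The star operation: the conjugate linear anti-multiplicative map with `a ↦ a*`, `c ↦ c*`. -/
def starA (x : A q) : A q := MulOpposite.unop (show (A q)ᵐᵒᵖ from liftA (isRep_star q) x)

variable {q}

theorem starA_mul (x y : A q) : starA q (x * y) = starA q y * starA q x := by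
  unfold starA; rw [map_mul]; rfl

theorem starA_add (x y : A q) : starA q (x + y) = starA q x + starA q y := by
  unfold starA; rw [map_add]; rfl

theorem starA_smul (r : ℂ) (x : A q) : starA q (r • x) = star r • starA q x := by
  unfold starA; rw [map_smul]
  exact congrArg MulOpposite.unop (ConjOp.smul_def q r _)

theorem starA_one : starA q 1 = 1 := by
  unfold starA; rw [map_one]; rfl

theorem starA_a : starA q (ga q) = gas q :=
  congrArg MulOpposite.unop (liftA_a (isRep_star q))
theorem starA_as : starA q (gas q) = ga q :=
  congrArg MulOpposite.unop (liftA_as (isRep_star q))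
theorem starA_c : starA q (gc q) = gcs q :=
  congrArg MulOpposite.unop (liftA_c (isRep_star q))
theorem starA_cs : starA q (gcs q) = gc q :=
  congrArg MulOpposite.unop (liftA_cs (isRep_star q))

theorem starA_starA (x : A q) : starA q (starA q x) = x := by
  induction x using induct with
  | h1 => simp [starA_one]
  | hs r x h => simp [starA_smul, h]
  | hadd x y hx hy => simp [starA_add, hx, hy]
  | hmul x y hx hy => simp [starA_mul, hx, hy]
  | ha => simp [starA_a, starA_as]
  | has => simp [starA_a, starA_as]
  | hc => simp [starA_c, starA_cs]
  | hcs => simp [starA_c, starA_cs]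

instance : StarRing (A q) where
  star := starA q
  star_involutive := starA_starA
  star_mul := starA_mul
  star_add := starA_add

instance : StarModule ℂ (A q) := ⟨starA_smul⟩

@[simp] theorem star_a : star (ga q) = gas q := starA_a
@[simp] theorem star_as : star (gas q) = ga q := starA_as
@[simp] theorem star_c : star (gc q) = gcs q := starA_c
@[simp] theorem star_cs : star (gcs q) = gc q := starA_cs

/-! The coproduct -/

theorem isRep_coprod : IsRep q
    (ga q ⊗ₜ[ℂ] ga q - qC q • (gcs q ⊗ₜ[ℂ] gc q))
    (gas q ⊗ₜ[ℂ] gas q - qC q • (gc q ⊗ₜ[ℂ] gcs q))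
    (gc q ⊗ₜ[ℂ] ga q + gas q ⊗ₜ[ℂ] gc q)
    (ga q ⊗ₜ[ℂ] gcs q + gcs q ⊗ₜ[ℂ] gas q) := by
  have hq := qC_ne q
  constructor <;>
  · simp only [mul_add, add_mul, sub_mul, mul_sub, smul_mul_assoc, mul_smul_comm,
      Algebra.TensorProduct.tmul_mul_tmul, r1, r2, r3, r4, r5, r6, r7, TensorProduct.tmul_sub,
      TensorProduct.sub_tmul, ← TensorProduct.smul_tmul', TensorProduct.tmul_smul,
      Algebra.TensorProduct.one_def, smul_sub, smul_smul]
    match_scalars <;> field_simp <;> ring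

variable (q)

/-- The coproduct of `A(SU_q(2))`. -/
def coprod : A q →ₐ[ℂ] A q ⊗[ℂ] A q := liftA isRep_coprod

/-- The map `x ↦ x₍₁₎ ⟨f, x₍₂₎⟩` of `A(SU_q(2))` attached to a linear functional `f`. -/
def leftAct (f : A q →ₗ[ℂ] ℂ) : A q →ₗ[ℂ] A q :=
  (TensorProduct.rid ℂ (A q)).toLinearMap ∘ₗ f.lTensor (A q) ∘ₗ (coprod q).toLinearMap

variable {q}

theorem leftAct_mul {f k l : A q →ₗ[ℂ] ℂ}
    (h : ∀ x y, f (x * y) = f x * k y + l x * f y) (x y : A q) :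
    leftAct q f (x * y) = leftAct q f x * leftAct q k y + leftAct q l x * leftAct q f y := by
  simp only [leftAct, LinearMap.comp_apply, AlgHom.toLinearMap_apply, map_mul,
    LinearEquiv.coe_coe]
  generalize coprod q x = X
  generalize coprod q y = Y
  induction X using TensorProduct.induction_on with
  | zero => simp
  | add X1 X2 h1 h2 => simp only [add_mul, map_add, h1, h2]; abel
  | tmul a b =>
    induction Y using TensorProduct.induction_on with
    | zero => simp
    | add X1 X2 h1 h2 => simp only [mul_add, map_add, h1, h2]; abel
    | tmul c d =>
      simp only [Algebra.TensorProduct.tmul_mul_tmul, LinearMap.lTensor_tmul,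
        TensorProduct.rid_tmul, h, smul_mul_assoc, mul_smul_comm, add_smul, mul_smul]
      rw [smul_comm (f b) (k d), smul_comm (f d) (l b)]

theorem leftAct_mul' {f : A q →ₗ[ℂ] ℂ} (h : ∀ x y, f (x * y) = f x * f y) (x y : A q) :
    leftAct q f (x * y) = leftAct q f x * leftAct q f y := by
  have := leftAct_mul (f := f) (k := f) (l := 0) (by simpa using h) x y
  simpa [leftAct] using this

theorem leftAct_a (f : A q →ₗ[ℂ] ℂ) :
    leftAct q f (ga q) = f (ga q) • ga q - (qC q * f (gc q)) • gcs q := by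
  simp [leftAct, coprod, smul_smul]
theorem leftAct_as (f : A q →ₗ[ℂ] ℂ) :
    leftAct q f (gas q) = f (gas q) • gas q - (qC q * f (gcs q)) • gc q := by
  simp [leftAct, coprod, smul_smul]
theorem leftAct_c (f : A q →ₗ[ℂ] ℂ) :
    leftAct q f (gc q) = f (ga q) • gc q + f (gc q) • gas q := by
  simp [leftAct, coprod]
theorem leftAct_cs (f : A q →ₗ[ℂ] ℂ) :
    leftAct q f (gcs q) = f (gcs q) • ga q + f (gas q) • gcs q := by
  simp [leftAct, coprod]

/-! The pairing of the generators `K`, `K⁻¹`, `E`, `F` with `A(SU_q(2))`.  By the coproduct of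
`E` and `F`, the matrices `[[⟨K⁻¹, x⟩, ⟨E, x⟩], [0, ⟨K, x⟩]]` and
`[[⟨K⁻¹, x⟩, ⟨F, x⟩], [0, ⟨K, x⟩]]` are multiplicative in `x`. -/

theorem isRep_pairE : IsRep q (!![qH q, 0; 0, (qH q)⁻¹] : Matrix (Fin 2) (Fin 2) ℂ)
    !![(qH q)⁻¹, 0; 0, qH q] !![0, 1; 0, 0] 0 := by
  have h := qH_ne q
  constructor <;> ext i j <;> fin_cases i <;> fin_cases j <;>
    simp [qC_eq, h] <;> field_simp

theorem isRep_pairF : IsRep q (!![qH q, 0; 0, (qH q)⁻¹] : Matrix (Fin 2) (Fin 2) ℂ)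
    !![(qH q)⁻¹, 0; 0, qH q] 0 !![0, -(qC q)⁻¹; 0, 0] := by
  have h := qH_ne q
  constructor <;> ext i j <;> fin_cases i <;> fin_cases j <;>
    simp [qC_eq, h] <;> field_simp

variable (q)

/-- The representation `x ↦ [[⟨K⁻¹, x⟩, ⟨E, x⟩], [0, ⟨K, x⟩]]`. -/
def repE : A q →ₐ[ℂ] Matrix (Fin 2) (Fin 2) ℂ := liftA isRep_pairE

/-- The representation `x ↦ [[⟨K⁻¹, x⟩, ⟨F, x⟩], [0, ⟨K, x⟩]]`. -/
def repF : A q →ₐ[ℂ] Matrix (Fin 2) (Fin 2) ℂ := liftA isRep_pairF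

/-- The pairing `⟨K, ·⟩`. -/
def pairK : A q →ₗ[ℂ] ℂ := Matrix.entryLinearMap ℂ ℂ 1 1 ∘ₗ (repE q).toLinearMap
/-- The pairing `⟨K⁻¹, ·⟩`. -/
def pairKi : A q →ₗ[ℂ] ℂ := Matrix.entryLinearMap ℂ ℂ 0 0 ∘ₗ (repE q).toLinearMap
/-- The pairing `⟨E, ·⟩`. -/
def pairE : A q →ₗ[ℂ] ℂ := Matrix.entryLinearMap ℂ ℂ 0 1 ∘ₗ (repE q).toLinearMap
/-- The pairing `⟨F, ·⟩`. -/
def pairF : A q →ₗ[ℂ] ℂ := Matrix.entryLinearMap ℂ ℂ 0 1 ∘ₗ (repF q).toLinearMap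

variable {q}

theorem repE_low (x : A q) : repE q x 1 0 = 0 := by
  induction x using induct with
  | h1 => simp
  | hs r x h => simp [h]
  | hadd x y hx hy => simp [hx, hy]
  | hmul x y hx hy => simp [Matrix.mul_apply, hx, hy]
  | _ => simp [repE]

theorem repF_eq (x : A q) : repF q x 0 0 = repE q x 0 0 ∧ repF q x 1 1 = repE q x 1 1 ∧
    repF q x 1 0 = 0 := by
  induction x using induct with
  | h1 => simp
  | hs r x h => simp [h]
  | hadd x y hx hy => simp [hx, hy]
  | hmul x y hx hy => simp [Matrix.mul_apply, hx, hy, repE_low]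
  | _ => simp [repE, repF]

theorem pairK_mul (x y : A q) : pairK q (x * y) = pairK q x * pairK q y := by
  simp [pairK, Matrix.mul_apply, repE_low]
theorem pairKi_mul (x y : A q) : pairKi q (x * y) = pairKi q x * pairKi q y := by
  simp [pairKi, Matrix.mul_apply, repE_low]
theorem pairE_mul (x y : A q) :
    pairE q (x * y) = pairE q x * pairK q y + pairKi q x * pairE q y := by
  simp [pairE, pairK, pairKi, Matrix.mul_apply]; ring
theorem pairF_mul (x y : A q) :
    pairF q (x * y) = pairF q x * pairK q y + pairKi q x * pairF q y := by
  simp [pairF, pairK, pairKi, Matrix.mul_apply, repF_eq]; ring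

variable (q)

/-- The action of `K` on `A(SU_q(2))`. -/
def opK : Module.End ℂ (A q) := leftAct q (pairK q)
/-- The action of `K⁻¹` on `A(SU_q(2))`. -/
def opKi : Module.End ℂ (A q) := leftAct q (pairKi q)
/-- The action of `E` on `A(SU_q(2))`. -/
def opE : Module.End ℂ (A q) := leftAct q (pairE q)
/-- The action of `F` on `A(SU_q(2))`. -/
def opF : Module.End ℂ (A q) := leftAct q (pairF q)

variable {q}

theorem opK_mul (x y : A q) : opK q (x * y) = opK q x * opK q y := leftAct_mul' pairK_mul x y
theorem opKi_mul (x y : A q) : opKi q (x * y) = opKi q x * opKi q y := leftAct_mul' pairKi_mul x y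
theorem opE_mul (x y : A q) : opE q (x * y) = opE q x * opK q y + opKi q x * opE q y :=
  leftAct_mul pairE_mul x y
theorem opF_mul (x y : A q) : opF q (x * y) = opF q x * opK q y + opKi q x * opF q y :=
  leftAct_mul pairF_mul x y

theorem leftAct_one (f : A q →ₗ[ℂ] ℂ) : leftAct q f 1 = f 1 • 1 := by
  simp [leftAct, Algebra.TensorProduct.one_def]

@[simp] theorem opK_one : opK q 1 = 1 := by simp [opK, leftAct_one, pairK]
@[simp] theorem opKi_one : opKi q 1 = 1 := by simp [opKi, leftAct_one, pairKi]
@[simp] theorem opE_one : opE q 1 = 0 := by simp [opE, leftAct_one, pairE]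
@[simp] theorem opF_one : opF q 1 = 0 := by simp [opF, leftAct_one, pairF]

@[simp] theorem opK_a : opK q (ga q) = (qH q)⁻¹ • ga q := by
  simp [opK, leftAct_a, pairK, repE]
@[simp] theorem opK_as : opK q (gas q) = qH q • gas q := by
  simp [opK, leftAct_as, pairK, repE]
@[simp] theorem opK_c : opK q (gc q) = (qH q)⁻¹ • gc q := by
  simp [opK, leftAct_c, pairK, repE]
@[simp] theorem opK_cs : opK q (gcs q) = qH q • gcs q := by
  simp [opK, leftAct_cs, pairK, repE]
@[simp] theorem opKi_a : opKi q (ga q) = qH q • ga q := by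
  simp [opKi, leftAct_a, pairKi, repE]
@[simp] theorem opKi_as : opKi q (gas q) = (qH q)⁻¹ • gas q := by
  simp [opKi, leftAct_as, pairKi, repE]
@[simp] theorem opKi_c : opKi q (gc q) = qH q • gc q := by
  simp [opKi, leftAct_c, pairKi, repE]
@[simp] theorem opKi_cs : opKi q (gcs q) = (qH q)⁻¹ • gcs q := by
  simp [opKi, leftAct_cs, pairKi, repE]
@[simp] theorem opE_a : opE q (ga q) = -(qC q • gcs q) := by
  simp [opE, leftAct_a, pairE, repE]
@[simp] theorem opE_as : opE q (gas q) = 0 := by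
  simp [opE, leftAct_as, pairE, repE]
@[simp] theorem opE_c : opE q (gc q) = gas q := by
  simp [opE, leftAct_c, pairE, repE]
@[simp] theorem opE_cs : opE q (gcs q) = 0 := by
  simp [opE, leftAct_cs, pairE, repE]
@[simp] theorem opF_a : opF q (ga q) = 0 := by
  simp [opF, leftAct_a, pairF, repF]
@[simp] theorem opF_as : opF q (gas q) = gc q := by
  simp [opF, leftAct_as, pairF, repF, qC_ne q]
@[simp] theorem opF_c : opF q (gc q) = 0 := by
  simp [opF, leftAct_c, pairF, repF]
@[simp] theorem opF_cs : opF q (gcs q) = -((qC q)⁻¹ • ga q) := by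
  simp [opF, leftAct_cs, pairF, repF]

/-! The quantum universal enveloping algebra `U_q(su(2))` and its action -/

/-- Generators of `U_q(su(2))`. -/
inductive UGen
  | K | Ki | E | F

variable (q) in
/-- The defining relations of `U_q(su(2))`. -/
inductive URel : FreeAlgebra ℂ UGen → FreeAlgebra ℂ UGen → Prop
  | KKi : URel (FreeAlgebra.ι ℂ UGen.K * FreeAlgebra.ι ℂ UGen.Ki) 1
  | KiK : URel (FreeAlgebra.ι ℂ UGen.Ki * FreeAlgebra.ι ℂ UGen.K) 1
  | KE : URel (FreeAlgebra.ι ℂ UGen.K * FreeAlgebra.ι ℂ UGen.E)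
      (qC q • (FreeAlgebra.ι ℂ UGen.E * FreeAlgebra.ι ℂ UGen.K))
  | KiE : URel (FreeAlgebra.ι ℂ UGen.Ki * FreeAlgebra.ι ℂ UGen.E)
      ((qC q)⁻¹ • (FreeAlgebra.ι ℂ UGen.E * FreeAlgebra.ι ℂ UGen.Ki))
  | KF : URel (FreeAlgebra.ι ℂ UGen.K * FreeAlgebra.ι ℂ UGen.F)
      ((qC q)⁻¹ • (FreeAlgebra.ι ℂ UGen.F * FreeAlgebra.ι ℂ UGen.K))
  | KiF : URel (FreeAlgebra.ι ℂ UGen.Ki * FreeAlgebra.ι ℂ UGen.F)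
      (qC q • (FreeAlgebra.ι ℂ UGen.F * FreeAlgebra.ι ℂ UGen.Ki))
  | EF : URel (FreeAlgebra.ι ℂ UGen.E * FreeAlgebra.ι ℂ UGen.F -
      FreeAlgebra.ι ℂ UGen.F * FreeAlgebra.ι ℂ UGen.E)
      ((qC q - (qC q)⁻¹)⁻¹ • (FreeAlgebra.ι ℂ UGen.K ^ 2 - FreeAlgebra.ι ℂ UGen.Ki ^ 2))

variable (q) in
/-- The algebra `U_q(su(2))`. -/
def Uq : Type := RingQuot (URel q)

instance : Ring (Uq q) := inferInstanceAs (Ring (RingQuot (URel q)))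
instance : Algebra ℂ (Uq q) := inferInstanceAs (Algebra ℂ (RingQuot (URel q)))

variable (q) in
/-- The class of a generator of `U_q(su(2))`. -/
def ugen (g : UGen) : Uq q := RingQuot.mkAlgHom ℂ (URel q) (FreeAlgebra.ι ℂ g)

variable (q) in
/-- The generator `K`. -/
def uK : Uq q := ugen q UGen.K
variable (q) in
/-- The generator `K⁻¹`. -/
def uKi : Uq q := ugen q UGen.Ki
variable (q) in
/-- The generator `E`. -/
def uE : Uq q := ugen q UGen.E
variable (q) in
/-- The generator `F`. -/
def uF : Uq q := ugen q UGen.F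

variable (q) in
/-- Action of the generators of `U_q(su(2))` on `A(SU_q(2))`. -/
def uVal : UGen → Module.End ℂ (A q)
  | UGen.K => opK q
  | UGen.Ki => opKi q
  | UGen.E => opE q
  | UGen.F => opF q

theorem opK_opKi (x : A q) : opK q (opKi q x) = x := by
  have h := qH_ne q
  induction x using induct with
  | h1 => simp
  | hs r x h => simp [h]
  | hadd x y hx hy => simp [hx, hy]
  | hmul x y hx hy => simp [opK_mul, opKi_mul, hx, hy]
  | _ => simp [smul_smul, h]

theorem opKi_opK (x : A q) : opKi q (opK q x) = x := by
  have h := qH_ne q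
  induction x using induct with
  | h1 => simp
  | hs r x h => simp [h]
  | hadd x y hx hy => simp [hx, hy]
  | hmul x y hx hy => simp [opK_mul, opKi_mul, hx, hy]
  | _ => simp [smul_smul, h]

theorem opK_opE (x : A q) : opK q (opE q x) = qC q • opE q (opK q x) := by
  have h := qH_ne q
  induction x using induct with
  | h1 => simp
  | hs r x h => simp [h, smul_comm r]
  | hadd x y hx hy => simp [hx, hy]
  | hmul x y hx hy => simp [opK_mul, opE_mul, hx, hy, opK_opKi, opKi_opK]
  | _ => simp [smul_smul, h, qC_eq, sq]

theorem opK_opF (x : A q) : opK q (opF q x) = (qC q)⁻¹ • opF q (opK q x) := by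
  have h := qH_ne q
  induction x using induct with
  | h1 => simp
  | hs r x h => simp [h, smul_comm r]
  | hadd x y hx hy => simp [hx, hy]
  | hmul x y hx hy => simp [opK_mul, opF_mul, hx, hy, opK_opKi, opKi_opK]
  | _ => simp [smul_smul, h, qC_eq, sq]

theorem opKi_opE (x : A q) : opKi q (opE q x) = (qC q)⁻¹ • opE q (opKi q x) := by
  have := congrArg (opKi q) (opK_opE (opKi q x))
  rw [opK_opKi, map_smul, opKi_opK] at this
  rw [this, smul_smul, inv_mul_cancel₀ (qC_ne q), one_smul]

theorem opKi_opF (x : A q) : opKi q (opF q x) = qC q • opF q (opKi q x) := by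
  have := congrArg (opKi q) (opK_opF (opKi q x))
  rw [opK_opKi, map_smul, opKi_opK] at this
  rw [this, smul_smul, mul_inv_cancel₀ (qC_ne q), one_smul]

theorem opE_opF (x : A q) : opE q (opF q x) - opF q (opE q x) =
    (qC q - (qC q)⁻¹)⁻¹ • (opK q (opK q x) - opKi q (opKi q x)) := by
  have h := qH_ne q
  have h' := qC_sub_ne q
  have hq := qC_ne q
  have hh : (qC q - (qC q)⁻¹)⁻¹ * (qC q - (qC q)⁻¹) = 1 := inv_mul_cancel₀ h'
  generalize hw : (qC q - (qC q)⁻¹)⁻¹ = w at *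
  have hH : qH q * qH q = qC q := qH_mul_self q
  have hH' : (qH q)⁻¹ * (qH q)⁻¹ = (qC q)⁻¹ := by rw [← mul_inv, hH]
  have e2 (y : A q) : y = w • (qC q • y - (qC q)⁻¹ • y) := by
    rw [← sub_smul, smul_smul, hh, one_smul]
  induction x using induct with
  | h1 => simp
  | hs r x hx => simp only [map_smul, ← smul_sub, hx]; rw [smul_comm]
  | hadd x y hx hy =>
    simp only [map_add]
    rw [add_sub_add_comm, hx, hy]; module
  | hmul x y hx hy =>
    have hx' := eq_add_of_sub_eq hx
    have hy' := eq_add_of_sub_eq hy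
    simp only [opE_mul, opF_mul, opK_mul, opKi_mul, map_add, hx', hy', opK_opE, opK_opF,
      opKi_opE, opKi_opF, smul_mul_assoc, mul_smul_comm, mul_add, add_mul, mul_sub, sub_mul]
    match_scalars <;> field_simp <;> ring
  | ha =>
    simp [smul_smul, hH, hH', hq]
    refine (congrArg Neg.neg (e2 _)).trans ?_
    rw [← smul_neg, neg_sub]
  | has => simp [smul_smul, hH, hH']; exact e2 _
  | hc =>
    simp [smul_smul, hH, hH']
    refine (congrArg Neg.neg (e2 _)).trans ?_
    rw [← smul_neg, neg_sub]
  | hcs => simp [smul_smul, hH, hH', hq]; exact e2 _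

variable (q) in
/-- The left action of `U_q(su(2))` on `A(SU_q(2))`: the algebra map into the linear
endomorphisms such that each generator `h` acts by `x ↦ x₍₁₎ ⟨h, x₍₂₎⟩`. -/
def act : Uq q →ₐ[ℂ] Module.End ℂ (A q) :=
  RingQuot.liftAlgHom ℂ ⟨FreeAlgebra.lift ℂ (uVal q), by
    intro x y hxy
    cases hxy <;> ext x
    · simpa [uVal] using opK_opKi x
    · simpa [uVal] using opKi_opK x
    · simpa [uVal] using opK_opE x
    · simpa [uVal] using opKi_opE x
    · simpa [uVal] using opK_opF x
    · simpa [uVal] using opKi_opF x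
    · simpa [uVal, sq] using opE_opF x⟩

theorem act_gen (g : UGen) : act q (ugen q g) = uVal q g := by
  unfold act ugen
  erw [RingQuot.liftAlgHom_mkAlgHom_apply]
  simp

@[simp] theorem act_K : act q (uK q) = opK q := act_gen _
@[simp] theorem act_Ki : act q (uKi q) = opKi q := act_gen _
@[simp] theorem act_E : act q (uE q) = opE q := act_gen _
@[simp] theorem act_F : act q (uF q) = opF q := act_gen _

variable (q)

/-- `X₊ = q^(1/2) E K`. -/
def Xp : Uq q := qH q • (uE q * uK q)

/-- `X₋ = q^(-1/2) F K`. -/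
def Xm : Uq q := (qH q)⁻¹ • (uF q * uK q)

/-- `X_z = (1 - K^4) / (1 - q^(-2))`. -/
def Xz : Uq q := (1 - qC q ^ (-2 : ℤ))⁻¹ • (1 - uK q ^ 4)

variable {q}

theorem Xp_mul (x y : A q) :
    act q (Xp q) (x * y) = x * act q (Xp q) y + act q (Xp q) x * act q (uK q ^ 2) y := by
  simp [Xp, sq, opK_mul, opE_mul, opKi_opK]; abel

theorem Xm_mul (x y : A q) :
    act q (Xm q) (x * y) = x * act q (Xm q) y + act q (Xm q) x * act q (uK q ^ 2) y := by
  simp [Xm, sq, opK_mul, opF_mul, opKi_opK]; abel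

@[simp] theorem Xp_one : act q (Xp q) 1 = 0 := by simp [Xp]
@[simp] theorem Xm_one : act q (Xm q) 1 = 0 := by simp [Xm]

/-! The Hopf projection onto `A(U(1))` and the algebra of the standard Podleś sphere -/

theorem isRep_proj : IsRep (B := LaurentPolynomial ℂ) q (LaurentPolynomial.T 1)
    (LaurentPolynomial.T (-1)) 0 0 := by
  constructor <;>
    simp only [mul_zero, zero_mul, smul_zero, add_zero, ← LaurentPolynomial.T_add] <;>
    exact LaurentPolynomial.T_zero

variable (q)

/-- The projection `π : A(SU_q(2)) → A(U(1)) = ℂ[z, z⁻¹]`. -/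
def proj : A q →ₐ[ℂ] LaurentPolynomial ℂ := liftA isRep_proj

/-- The right coaction `(id ⊗ π) ∘ Δ`. -/
def coaction : A q →ₐ[ℂ] A q ⊗[ℂ] LaurentPolynomial ℂ :=
  (Algebra.TensorProduct.map (AlgHom.id ℂ (A q)) (proj q)).comp (coprod q)

/-- The algebra `A(S_q²)` of coinvariant elements. -/
def Sphere : Subalgebra ℂ (A q) :=
  AlgHom.equalizer (coaction q) (Algebra.TensorProduct.includeLeft : A q →ₐ[ℂ] _)

/-- The space `L_n = {x | K ▷ x = q^(n/2) x}`. -/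
def L (n : ℤ) : Submodule ℂ (A q) := Module.End.eigenspace (act q (uK q)) (qH q ^ n)

variable {q}

theorem mem_L {n : ℤ} {x : A q} : x ∈ L q n ↔ opK q x = qH q ^ n • x := by
  rw [L, Module.End.mem_eigenspace_iff, act_K]

theorem mem_Sphere {x : A q} : x ∈ Sphere q ↔ coaction q x = x ⊗ₜ 1 := Iff.rfl

theorem L_mul {m n : ℤ} {x y : A q} (hx : x ∈ L q m) (hy : y ∈ L q n) : x * y ∈ L q (m + n) := by
  rw [mem_L] at *
  rw [opK_mul, hx, hy, smul_mul_smul_comm, zpow_add₀ (qH_ne q)]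

theorem L_one : (1 : A q) ∈ L q 0 := by simp [mem_L]
theorem L_a : ga q ∈ L q (-1) := by simp [mem_L]
theorem L_as : gas q ∈ L q 1 := by simp [mem_L]
theorem L_c : gc q ∈ L q (-1) := by simp [mem_L]
theorem L_cs : gcs q ∈ L q 1 := by simp [mem_L]

theorem L_pow {m : ℤ} {x : A q} (hx : x ∈ L q m) (k : ℕ) : x ^ k ∈ L q (k * m) := by
  induction k with
  | zero => simpa using L_one
  | succ k ih =>
    rw [pow_succ]
    have := L_mul ih hx
    convert this using 2
    push_cast; ring

/-- Elements of `L_n` on which the coaction is `x ↦ x ⊗ z^(-n)`. -/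
def homog (q : Set.Ioo (0 : ℝ) 1) (n : ℤ) : Submodule ℂ (A q) :=
  L q n ⊓ LinearMap.ker ((coaction q).toLinearMap -
    (TensorProduct.mk ℂ (A q) (LaurentPolynomial ℂ)).flip (LaurentPolynomial.T (-n)))

theorem mem_homog {n : ℤ} {x : A q} :
    x ∈ homog q n ↔ x ∈ L q n ∧ coaction q x = x ⊗ₜ LaurentPolynomial.T (-n) := by
  simp [homog, sub_eq_zero]

theorem homog_mul {m n : ℤ} {x y : A q} (hx : x ∈ homog q m) (hy : y ∈ homog q n) :
    x * y ∈ homog q (m + n) := by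
  rw [mem_homog] at *
  refine ⟨L_mul hx.1 hy.1, ?_⟩
  rw [map_mul, hx.2, hy.2, Algebra.TensorProduct.tmul_mul_tmul, ← LaurentPolynomial.T_add,
    neg_add]

theorem iSup_homog : ⨆ n, homog q n = ⊤ := by
  refine eq_top_iff.2 fun x _ => ?_
  have key (n : ℤ) (x : A q) (h : x ∈ homog q n) : x ∈ ⨆ n, homog q n :=
    Submodule.mem_iSup_of_mem n h
  induction x using induct with
  | h1 => exact key 0 _ (by simp [mem_homog, L_one, Algebra.TensorProduct.one_def])
  | hs r x h => exact Submodule.smul_mem _ _ (h trivial)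
  | hadd x y hx hy => exact Submodule.add_mem _ (hx trivial) (hy trivial)
  | hmul x y hx hy =>
    refine Submodule.iSup_induction _ (motive := fun x => x * y ∈ ⨆ n, homog q n) (hx trivial)
      (fun m x hx => ?_) (by simp) (fun x x' h h' => by rw [add_mul]; exact add_mem h h')
    refine Submodule.iSup_induction _ (motive := fun y => x * y ∈ ⨆ n, homog q n) (hy trivial)
      (fun n y hy => key _ _ (homog_mul hx hy)) (by simp)
      (fun x x' h h' => by rw [mul_add]; exact add_mem h h')
  | ha => exact key (-1) _ (by simp [mem_homog, L_a, coaction, coprod, proj])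
  | has => exact key 1 _ (by simp [mem_homog, L_as, coaction, coprod, proj])
  | hc => exact key (-1) _ (by simp [mem_homog, L_c, coaction, coprod, proj])
  | hcs => exact key 1 _ (by simp [mem_homog, L_cs, coaction, coprod, proj])

theorem homog_eq_L : homog q = L q := by
  have h1 : iSupIndep (L q) :=
    (Module.End.eigenspaces_iSupIndep (act q (uK q))).comp (f := fun n : ℤ => qH q ^ n)
      (fun m n h => qH_zpow_inj q h)
  exact (h1.le_iff_eq_of_iSup_eq_top iSup_homog).1 fun n => inf_le_left

/-- Evaluation of Laurent polynomials at `z = q^(-1/2)`. -/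
def evalU (q : Set.Ioo (0 : ℝ) 1) : LaurentPolynomial ℂ →ₐ[ℂ] ℂ :=
  AddMonoidAlgebra.lift ℂ ℂ ℤ
    ((Units.coeHom ℂ).comp (zpowersHom ℂˣ (Units.mk0 (qH q)⁻¹ (inv_ne_zero (qH_ne q)))))

theorem evalU_T (n : ℤ) : evalU q (LaurentPolynomial.T n) = (qH q)⁻¹ ^ n := by
  unfold evalU
  erw [AddMonoidAlgebra.lift_single]
  simp

theorem pairK_eq (x : A q) : pairK q x = evalU q (proj q x) := by
  induction x using induct with
  | h1 => simp [pairK]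
  | hs r x h => simp [h]
  | hadd x y hx hy => simp [hx, hy]
  | hmul x y hx hy => simp [pairK_mul, hx, hy]
  | _ => simp [pairK, repE, proj, evalU_T]

/-- The algebra of coinvariants is `L_0`. -/
theorem mem_Sphere_iff {x : A q} : x ∈ Sphere q ↔ x ∈ L q 0 := by
  constructor
  · intro h
    have h2 (X : A q ⊗[ℂ] A q) :
        TensorProduct.rid ℂ (A q) ((pairK q).lTensor (A q) X) =
        TensorProduct.rid ℂ (A q) ((evalU q).toLinearMap.lTensor (A q)
          (Algebra.TensorProduct.map (AlgHom.id ℂ (A q)) (proj q) X)) := by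
      induction X using TensorProduct.induction_on with
      | zero => simp
      | tmul a b => simp [pairK_eq]
      | add a b ha hb => simp only [map_add, ha, hb]
    have h3 : opK q x = TensorProduct.rid ℂ (A q) ((evalU q).toLinearMap.lTensor (A q)
          (coaction q x)) := h2 _
    rw [mem_Sphere.1 h] at h3
    simpa [mem_L] using h3
  · intro h
    rw [← homog_eq_L, mem_homog] at h
    simpa [mem_Sphere] using h.2

theorem Xp_mem {n : ℤ} {x : A q} (hx : x ∈ L q n) : act q (Xp q) x ∈ L q (n + 2) := by
  rw [mem_L] at *
  have h := qH_ne q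
  simp only [Xp, map_smul, map_mul, act_K, act_E, LinearMap.smul_apply, Module.End.mul_apply,
    opK_opE, hx, smul_smul]
  congr 1
  rw [zpow_add₀ h, qC_eq]; norm_cast; ring

theorem Xm_mem {n : ℤ} {x : A q} (hx : x ∈ L q n) : act q (Xm q) x ∈ L q (n - 2) := by
  rw [mem_L] at *
  have h := qH_ne q
  simp only [Xm, map_smul, map_mul, act_K, act_F, LinearMap.smul_apply, Module.End.mul_apply,
    opK_opF, hx, smul_smul]
  congr 1
  rw [zpow_sub₀ h, qC_eq]; norm_cast; field_simp

theorem K2_L {n : ℤ} {x : A q} (hx : x ∈ L q n) : act q (uK q ^ 2) x = qC q ^ n • x := by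
  rw [mem_L] at hx
  rw [map_pow, act_K, sq, Module.End.mul_apply, hx, map_smul, hx, smul_smul,
    ← mul_zpow, qH_mul_self]

theorem coe_L (b : Sphere q) : (b : A q) ∈ L q 0 := mem_Sphere_iff.1 b.2

theorem mul_mem_left {n : ℤ} (b : Sphere q) (x : L q n) : (b : A q) * x ∈ L q n := by
  simpa using L_mul (coe_L b) x.2

theorem mul_mem_right {n : ℤ} (b : Sphere q) (x : L q n) : (x : A q) * b ∈ L q n := by
  simpa using L_mul x.2 (coe_L b)

/-- Left multiplication by `A(S_q²)` on `L_n`. -/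
instance instLeftL (n : ℤ) : Module (Sphere q) (L q n) where
  smul b x := ⟨b * x, mul_mem_left b x⟩
  one_smul _ := Subtype.ext (one_mul _)
  mul_smul _ _ _ := Subtype.ext (mul_assoc _ _ _)
  smul_zero _ := Subtype.ext (mul_zero _)
  smul_add _ _ _ := Subtype.ext (mul_add _ _ _)
  add_smul _ _ _ := Subtype.ext (add_mul _ _ _)
  zero_smul _ := Subtype.ext (zero_mul _)

/-- Right multiplication by `A(S_q²)` on `L_n`. -/
instance instRightL (n : ℤ) : Module (Sphere q)ᵐᵒᵖ (L q n) where
  smul b x := ⟨x * b.unop, mul_mem_right b.unop x⟩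
  one_smul _ := Subtype.ext (mul_one _)
  mul_smul _ _ _ := Subtype.ext (mul_assoc _ _ _).symm
  smul_zero _ := Subtype.ext (zero_mul _)
  smul_add _ _ _ := Subtype.ext (add_mul _ _ _)
  add_smul _ _ _ := Subtype.ext (mul_add _ _ _)
  zero_smul _ := Subtype.ext (mul_zero _)

instance (n : ℤ) : SMul (Sphere q) (L q n) := (instLeftL n).toSMul
instance (n : ℤ) : SMul (Sphere q)ᵐᵒᵖ (L q n) := (instRightL n).toSMul
instance : Module (Sphere q)ᵐᵒᵖ (Sphere q) := Semiring.toOppositeModule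
instance : SMul (Sphere q)ᵐᵒᵖ (Sphere q) := Mul.toSMulMulOpposite _

@[simp] theorem coe_smul_L {n : ℤ} (b : Sphere q) (x : L q n) :
    ((b • x : L q n) : A q) = b * x := rfl
@[simp] theorem coe_op_smul_L {n : ℤ} (b : (Sphere q)ᵐᵒᵖ) (x : L q n) :
    ((b • x : L q n) : A q) = x * b.unop := rfl

instance (n : ℤ) : SMulCommClass (Sphere q) (Sphere q)ᵐᵒᵖ (L q n) :=
  ⟨fun _ _ _ => Subtype.ext (mul_assoc _ _ _).symm⟩
instance (n : ℤ) : IsScalarTower ℂ (Sphere q) (L q n) :=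
  ⟨fun _ _ _ => Subtype.ext (smul_mul_assoc _ _ _)⟩
instance (n : ℤ) : IsScalarTower ℂ (Sphere q)ᵐᵒᵖ (L q n) :=
  ⟨fun _ _ _ => Subtype.ext (mul_smul_comm _ _ _)⟩

/-! The two-dimensional differential calculus on the sphere -/

variable (q)

/-- The bimodule of one-forms: the pair `(x, y)` is the form `x ω₋ + y ω₊`. -/
abbrev Form1 : Type := L q (-2) × L q 2

/-- The bimodule of two-forms: `f` is the form `f ω₊ ∧ ω₋`. -/
abbrev Form2 : Type := Sphere q

/-- The differential of functions, `f ↦ (X₋ ▷ f) ω₋ + (X₊ ▷ f) ω₊`. -/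
def d0 : Sphere q →ₗ[ℂ] Form1 q where
  toFun f := (⟨act q (Xm q) f, by simpa using Xm_mem (coe_L f)⟩,
    ⟨act q (Xp q) f, by simpa using Xp_mem (coe_L f)⟩)
  map_add' f g := by ext <;> simp
  map_smul' r f := by ext <;> simp

/-- The differential of one-forms, `x ω₋ + y ω₊ ↦ (X₊ ▷ x - q⁻² X₋ ▷ y) ω₊ ∧ ω₋`. -/
def d1 : Form1 q →ₗ[ℂ] Form2 q where
  toFun α := ⟨act q (Xp q) α.1 - qC q ^ (-2 : ℤ) • act q (Xm q) α.2, mem_Sphere_iff.2 <|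
    Submodule.sub_mem _ (by simpa using Xp_mem α.1.2)
      (Submodule.smul_mem _ _ (by simpa using Xm_mem α.2.2))⟩
  map_add' f g := by ext; simp; abel
  map_smul' r f := by ext; simp [smul_sub, smul_comm r]

/-- The product of one-forms,
`(x ω₋ + y ω₊) ∧ (t ω₋ + z ω₊) = (q⁻² y t - x z) ω₊ ∧ ω₋`. -/
def wedge : Form1 q →ₗ[ℂ] Form1 q →ₗ[ℂ] Form2 q :=
  LinearMap.mk₂ ℂ (fun α β => ⟨qC q ^ (-2 : ℤ) • ((α.2 : A q) * β.1) - (α.1 : A q) * β.2,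
    mem_Sphere_iff.2 <| Submodule.sub_mem _
      (Submodule.smul_mem _ _ (by simpa using L_mul α.2.2 β.1.2))
      (by simpa using L_mul α.1.2 β.2.2)⟩)
    (fun α α' β => by ext; simp [add_mul]; abel)
    (fun r α β => by ext; simp [smul_sub, smul_comm r])
    (fun α β β' => by ext; simp [mul_add]; abel)
    (fun r α β => by ext; simp [smul_sub, smul_comm r])

/-- The Hodge operator on one-forms: `-1` on the multiples of `ω₋`, `+1` on those of `ω₊`. -/
def hodge1 : Form1 q →ₗ[ℂ] Form1 q := LinearMap.prodMap (-LinearMap.id) LinearMap.id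

/-- The Hodge operator on two-forms, `f ω₊ ∧ ω₋ ↦ f`. -/
def hodge2 : Form2 q →ₗ[ℂ] Sphere q := LinearMap.id

variable {q}

theorem d0_mul (f g : Sphere q) : d0 q (f * g) = MulOpposite.op g • d0 q f + f • d0 q g := by
  have h : (opK q ^ 2) (g : A q) = g := by simpa using K2_L (coe_L g)
  ext <;> simp [d0, Xp_mul, Xm_mul, h, add_comm]

theorem d1_mul (α : Form1 q) (b : Sphere q) :
    d1 q (MulOpposite.op b • α) = MulOpposite.op b • d1 q α - wedge q α (d0 q b) := by
  have h : (opK q ^ 2) (b : A q) = b := by simpa using K2_L (coe_L b)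
  ext
  simp [d0, d1, wedge, Xp_mul, Xm_mul, h, sub_mul]
  abel

theorem wedge_op (α β : Form1 q) (b : Sphere q) :
    wedge q α (MulOpposite.op b • β) = MulOpposite.op b • wedge q α β := by
  ext
  simp [wedge, sub_mul, mul_assoc]

theorem wedge_mid (α β : Form1 q) (b : Sphere q) :
    wedge q (MulOpposite.op b • α) β = wedge q α (b • β) := by
  ext
  simp [wedge, mul_assoc]

theorem hodge1_op (α : Form1 q) (b : Sphere q) :
    hodge1 q (MulOpposite.op b • α) = MulOpposite.op b • hodge1 q α := by
  simp [hodge1]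

/-! The tensor product over a noncommutative algebra -/

section BTensor

variable (B M N : Type) [Ring B] [AddCommGroup M] [Module ℂ M] [Module Bᵐᵒᵖ M]
  [AddCommGroup N] [Module ℂ N] [Module B N]

/-- The relations `m b ⊗ n = m ⊗ b n`. -/
def BTensor.rel : Submodule ℂ (M ⊗[ℂ] N) :=
  Submodule.span ℂ {t | ∃ (m : M) (b : B) (n : N),
    t = (MulOpposite.op b • m) ⊗ₜ[ℂ] n - m ⊗ₜ[ℂ] (b • n)}

/-- The tensor product `M ⊗_B N` of a right `B`-module and a left `B`-module. -/
def BTensor : Type := (M ⊗[ℂ] N) ⧸ BTensor.rel B M N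

instance : AddCommGroup (BTensor B M N) :=
  inferInstanceAs (AddCommGroup ((M ⊗[ℂ] N) ⧸ BTensor.rel B M N))
instance : Module ℂ (BTensor B M N) :=
  inferInstanceAs (Module ℂ ((M ⊗[ℂ] N) ⧸ BTensor.rel B M N))

/-- The quotient map `M ⊗_ℂ N → M ⊗_B N`. -/
def BTensor.mkQ : M ⊗[ℂ] N →ₗ[ℂ] BTensor B M N := (BTensor.rel B M N).mkQ

variable {M N}

/-- The elementary tensor `m ⊗ n` in `M ⊗_B N`. -/
def BTensor.tmul : M →ₗ[ℂ] N →ₗ[ℂ] BTensor B M N :=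
  (TensorProduct.mk ℂ M N).compr₂ (BTensor.mkQ B M N)

variable {B}

theorem BTensor.tmul_smul (m : M) (b : B) (n : N) :
    BTensor.tmul B (MulOpposite.op b • m) n = BTensor.tmul B m (b • n) :=
  (Submodule.Quotient.eq _).2 (Submodule.subset_span ⟨m, b, n, rfl⟩)

variable {P : Type} [AddCommGroup P] [Module ℂ P]

/-- The universal property of `M ⊗_B N`. -/
def BTensor.lift (f : M →ₗ[ℂ] N →ₗ[ℂ] P)
    (hf : ∀ (m : M) (b : B) (n : N), f (MulOpposite.op b • m) n = f m (b • n)) :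
    BTensor B M N →ₗ[ℂ] P :=
  (BTensor.rel B M N).liftQ (TensorProduct.lift f) <| by
    rw [BTensor.rel, Submodule.span_le]
    rintro _ ⟨m, b, n, rfl⟩
    simp [hf]

@[simp] theorem BTensor.lift_tmul (f : M →ₗ[ℂ] N →ₗ[ℂ] P)
    (hf : ∀ (m : M) (b : B) (n : N), f (MulOpposite.op b • m) n = f m (b • n)) (m : M) (n : N) :
    BTensor.lift f hf (BTensor.tmul B m n) = f m n :=
  TensorProduct.lift.tmul m n

theorem BTensor.ext {f g : BTensor B M N →ₗ[ℂ] P}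
    (h : ∀ m n, f (BTensor.tmul B m n) = g (BTensor.tmul B m n)) : f = g := by
  refine Submodule.linearMap_qext (BTensor.rel B M N) ?_
  apply TensorProduct.ext'
  intro m n
  exact h m n

variable {M' : Type} [AddCommGroup M'] [Module ℂ M'] [Module Bᵐᵒᵖ M']

/-- The map `f ⊗ id` induced by a right `B`-linear map `f`. -/
def BTensor.map (f : M →ₗ[ℂ] M')
    (hf : ∀ (m : M) (b : B), f (MulOpposite.op b • m) = MulOpposite.op b • f m) :
    BTensor B M N →ₗ[ℂ] BTensor B M' N :=
  BTensor.lift ((BTensor.tmul B).comp f) fun m b n => by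
    simp [hf, BTensor.tmul_smul]

@[simp] theorem BTensor.map_tmul (f : M →ₗ[ℂ] M')
    (hf : ∀ (m : M) (b : B), f (MulOpposite.op b • m) = MulOpposite.op b • f m) (m : M) (n : N) :
    BTensor.map f hf (BTensor.tmul B m n) = BTensor.tmul B (f m) n := by
  simp [BTensor.map]

/-- Left multiplication by `b` on `M ⊗_B N`, for a bimodule `M`. -/
def BTensor.lsmul [Module B M] [SMulCommClass B Bᵐᵒᵖ M] [SMulCommClass B ℂ M] (b : B) :
    BTensor B M N →ₗ[ℂ] BTensor B M N :=
  BTensor.map (DistribSMul.toLinearMap ℂ M b) fun m b' => smul_comm b (MulOpposite.op b') m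

@[simp] theorem BTensor.lsmul_tmul [Module B M] [SMulCommClass B Bᵐᵒᵖ M] [SMulCommClass B ℂ M]
    (b : B) (m : M) (n : N) :
    BTensor.lsmul b (BTensor.tmul B m n) = BTensor.tmul B (b • m) n :=
  BTensor.map_tmul _ _ m n

end BTensor

/-! Covariant derivatives and the gauged Laplacian -/

instance (n : ℤ) : SMulCommClass (Sphere q) ℂ (L q n) :=
  ⟨fun _ _ _ => Subtype.ext (mul_smul_comm _ _ _)⟩

section Connection

variable (q)

/-- A covariant derivative on a left `A(S_q²)`-module `E`. -/
structure Connection (E : Type) [AddCommGroup E] [Module ℂ E] [Module (Sphere q) E] where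
  /-- The underlying linear map `∇ : E → Ω¹(S_q²) ⊗ E`. -/
  nabla : E →ₗ[ℂ] BTensor (Sphere q) (Form1 q) E
  leibniz : ∀ (f : Sphere q) (φ : E),
    nabla (f • φ) = BTensor.lsmul f (nabla φ) + BTensor.tmul (Sphere q) (d0 q f) φ

variable {q}
variable {E : Type} [AddCommGroup E] [Module ℂ E] [Module (Sphere q) E]

/-- The map `β ⊗ φ ↦ (α ∧ β) ⊗ φ` attached to a one-form `α`. -/
def wedgeT (α : Form1 q) :
    BTensor (Sphere q) (Form1 q) E →ₗ[ℂ] BTensor (Sphere q) (Form2 q) E :=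
  BTensor.map (wedge q α) (wedge_op α)

@[simp] theorem wedgeT_tmul (α β : Form1 q) (φ : E) :
    wedgeT α (BTensor.tmul (Sphere q) β φ) = BTensor.tmul (Sphere q) (wedge q α β) φ := by
  simp [wedgeT]

theorem wedgeT_mid (α : Form1 q) (b : Sphere q) (t : BTensor (Sphere q) (Form1 q) E) :
    wedgeT (MulOpposite.op b • α) t = wedgeT α (BTensor.lsmul b t) := by
  have : wedgeT (E := E) (MulOpposite.op b • α) = (wedgeT α).comp (BTensor.lsmul b) := by
    apply BTensor.ext
    intro β φ
    simp [wedge_mid]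
  exact congrArg (fun f => f t) this

theorem wedgeT_add (α β : Form1 q) (t : BTensor (Sphere q) (Form1 q) E) :
    wedgeT (α + β) t = wedgeT α t + wedgeT β t := by
  have : wedgeT (E := E) (α + β) = wedgeT α + wedgeT β := by
    apply BTensor.ext
    intro γ φ
    simp
  exact congrArg (fun f => f t) this

theorem wedgeT_smul (r : ℂ) (α : Form1 q) (t : BTensor (Sphere q) (Form1 q) E) :
    wedgeT (r • α) t = r • wedgeT α t := by
  have : wedgeT (E := E) (r • α) = r • wedgeT α := by
    apply BTensor.ext
    intro γ φ
    simp
  exact congrArg (fun f => f t) this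

/-- The extension of a covariant derivative to `E`-valued one-forms,
`∇(α ⊗ φ) = dα ⊗ φ - α ∧ ∇φ`. -/
def Connection.nabla1 (D : Connection q E) :
    BTensor (Sphere q) (Form1 q) E →ₗ[ℂ] BTensor (Sphere q) (Form2 q) E :=
  BTensor.lift
    (LinearMap.mk₂ ℂ
      (fun α φ => BTensor.tmul (Sphere q) (d1 q α) φ - wedgeT α (D.nabla φ))
      (fun α β φ => by simp only [map_add, LinearMap.add_apply, wedgeT_add]; abel)
      (fun r α φ => by simp only [map_smul, LinearMap.smul_apply, wedgeT_smul, smul_sub])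
      (fun α φ ψ => by simp only [map_add]; abel)
      (fun r α φ => by simp only [map_smul, smul_sub]))
    (fun α b φ => by
      simp only [LinearMap.mk₂_apply, D.leibniz, map_add, d1_mul, map_sub, LinearMap.sub_apply,
        wedgeT_mid, wedgeT_tmul, BTensor.tmul_smul]
      abel)

/-- The operator `⋆ ⊗ id` on `E`-valued one-forms. -/
def hodgeT1 : BTensor (Sphere q) (Form1 q) E →ₗ[ℂ] BTensor (Sphere q) (Form1 q) E :=
  BTensor.map (hodge1 q) hodge1_op

/-- The operator `⋆ ⊗ id` on `E`-valued two-forms, with values in `A(S_q²) ⊗ E = E`. -/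
def hodgeT2 [IsScalarTower ℂ (Sphere q) E] : BTensor (Sphere q) (Form2 q) E →ₗ[ℂ] E :=
  BTensor.lift
    (LinearMap.mk₂ ℂ (fun f φ => hodge2 q f • φ)
      (fun f g φ => by simp [add_smul])
      (fun r f φ => by simp)
      (fun f φ ψ => by simp)
      (fun r f φ => by
        rw [← algebraMap_smul (Sphere q) r φ, ← mul_smul, ← Algebra.commutes, mul_smul,
          algebraMap_smul]))
    (fun f b φ => by simp [hodge2, mul_smul])

/-- The gauged Laplacian `□_∇ = -½ ⋆ ∇ ⋆ ∇`. -/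
def gaugedLaplacian [IsScalarTower ℂ (Sphere q) E] (D : Connection q E) : E →ₗ[ℂ] E :=
  (-(1 / 2) : ℂ) • (hodgeT2 ∘ₗ D.nabla1 ∘ₗ hodgeT1 ∘ₗ D.nabla)

end Connection

/-! The vectors `Ψ^(n)` and the projections `p^(n)` -/

section gauss

variable {R : Type} [Ring R] [Algebra ℂ R]

/-- `s^j` times the Gaussian binomial coefficient `[n, j]_Q`. -/
def gauss (s Q : ℂ) (n j : ℕ) : ℂ :=
  s ^ j * ∏ i ∈ Finset.range j, (1 - Q ^ ((n : ℤ) - i)) / (1 - Q ^ ((i : ℤ) + 1))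

theorem gauss_last (s Q : ℂ) (n : ℕ) : gauss s Q n (n + 1) = 0 := by
  simp [gauss, Finset.prod_range_succ]

theorem gauss_succ {s Q : ℂ} (hQ : Q ≠ 0) (h1 : ∀ i : ℕ, 1 - Q ^ ((i : ℤ) + 1) ≠ 0) (n j : ℕ) :
    gauss s Q (n + 1) (j + 1) =
      gauss s Q n (j + 1) + s * Q ^ ((n : ℤ) - j) * gauss s Q n j := by
  have e1 : gauss s Q n (j + 1) =
      gauss s Q n j * s * ((1 - Q ^ ((n : ℤ) - j)) / (1 - Q ^ ((j : ℤ) + 1))) := by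
    simp only [gauss, Finset.prod_range_succ]; ring
  have e2 : gauss s Q (n + 1) (j + 1) =
      gauss s Q n j * s * ((1 - Q ^ ((n : ℤ) + 1)) / (1 - Q ^ ((j : ℤ) + 1))) := by
    simp only [gauss, Finset.prod_div_distrib]
    rw [Finset.prod_range_succ' (fun i : ℕ => 1 - Q ^ (((n + 1 : ℕ) : ℤ) - (i : ℤ))),
      Finset.prod_range_succ (fun i : ℕ => 1 - Q ^ ((i : ℤ) + 1))]
    have : ∀ i : ℕ, ((n + 1 : ℕ) : ℤ) - ((i + 1 : ℕ) : ℤ) = (n : ℤ) - i := by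
      intro i; push_cast; ring
    simp only [this]
    simp only [Nat.cast_add, Nat.cast_one, Nat.cast_zero, sub_zero, div_eq_mul_inv, mul_inv]
    ring
  rw [e1, e2]
  have e3 : Q ^ ((n : ℤ) + 1) = Q ^ ((n : ℤ) - j) * Q ^ ((j : ℤ) + 1) := by
    rw [← zpow_add₀ hQ]; congr 1; ring
  rw [e3]
  have := h1 j
  field_simp
  ring

theorem pow_mul_comm_smul {x t : R} {r : ℂ} (h : x * t = r • (t * x)) (k : ℕ) :
    x ^ k * t = r ^ k • (t * x ^ k) := by
  induction k with
  | zero => simp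
  | succ k ih =>
    rw [pow_succ', mul_assoc, ih, mul_smul_comm, ← mul_assoc, h, smul_mul_assoc, smul_smul,
      mul_assoc, pow_succ]

theorem gauss_sum {s Q r : ℂ} (hQr : Q * r = 1) (h1 : ∀ i : ℕ, 1 - Q ^ ((i : ℤ) + 1) ≠ 0)
    {x y t : R} (hxt : x * t = r • (t * x)) (hxy : x * y = 1 - s • t) (n : ℕ) :
    ∑ j ∈ Finset.range (n + 1), gauss s Q n j • (x ^ (n - j) * t ^ j * y ^ (n - j)) = 1 := by
  have hQ : Q ≠ 0 := left_ne_zero_of_mul_eq_one hQr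
  induction n with
  | zero => simp [gauss]
  | succ n ih =>
    rw [Finset.sum_range_succ']
    have e : ∀ j ∈ Finset.range (n + 1),
        gauss s Q (n + 1) (j + 1) •
          (x ^ (n + 1 - (j + 1)) * t ^ (j + 1) * y ^ (n + 1 - (j + 1))) =
        gauss s Q n (j + 1) • (x ^ (n + 1 - (j + 1)) * t ^ (j + 1) * y ^ (n + 1 - (j + 1))) +
          (s • t) * (gauss s Q n j • (x ^ (n - j) * t ^ j * y ^ (n - j))) := by
      intro j hj
      have hj' : j ≤ n := Nat.lt_succ_iff.1 (Finset.mem_range.1 hj)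
      rw [gauss_succ hQ h1, add_smul]
      congr 1
      rw [Nat.add_sub_add_right, pow_succ' t, ← mul_assoc, pow_mul_comm_smul hxt]
      have hz : Q ^ ((n : ℤ) - j) * r ^ (n - j) = 1 := by
        rw [← Nat.cast_sub hj', zpow_natCast, ← mul_pow, hQr, one_pow]
      simp only [smul_mul_assoc, mul_smul_comm, smul_smul, mul_assoc]
      congr 1
      linear_combination (s * gauss s Q n j) * hz
    rw [Finset.sum_congr rfl e, Finset.sum_add_distrib, ← Finset.mul_sum, ih, mul_one]
    have e0 : gauss s Q (n + 1) 0 = gauss s Q n 0 := by simp [gauss]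
    rw [e0, add_right_comm,
      ← Finset.sum_range_succ' (fun j => gauss s Q n j •
        (x ^ (n + 1 - j) * t ^ j * y ^ (n + 1 - j))),
      Finset.sum_range_succ, gauss_last, zero_smul, add_zero]
    have e2 : ∀ j ∈ Finset.range (n + 1),
        gauss s Q n j • (x ^ (n + 1 - j) * t ^ j * y ^ (n + 1 - j)) =
        x * (gauss s Q n j • (x ^ (n - j) * t ^ j * y ^ (n - j))) * y := by
      intro j hj
      have hj' : j ≤ n := Nat.lt_succ_iff.1 (Finset.mem_range.1 hj)
      rw [Nat.succ_sub hj', pow_succ' x, pow_succ y]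
      simp only [smul_mul_assoc, mul_smul_comm, mul_assoc]
    rw [Finset.sum_congr rfl e2, ← Finset.sum_mul, ← Finset.mul_sum, ih, mul_one, hxy]
    abel

end gauss

variable (q)

/-- The coefficient `β_{n,μ}`. -/
def beta (n μ : ℕ) : ℝ :=
  (q : ℝ) ^ (2 * μ) * ∏ j ∈ Finset.range μ,
    (1 - (q : ℝ) ^ (-2 * ((n : ℤ) - j))) / (1 - (q : ℝ) ^ (-2 * ((j : ℤ) + 1)))

/-- The coefficient `α_{n,μ}`, with `N = |n|`. -/
def alpha (N μ : ℕ) : ℝ :=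
  ∏ j ∈ Finset.range (N - μ),
    (1 - (q : ℝ) ^ (2 * ((N : ℤ) - j))) / (1 - (q : ℝ) ^ (2 * ((j : ℤ) + 1)))

/-- The components of the vector `|Ψ^(n)⟩`. -/
def ket (n : ℤ) (μ : Fin (n.natAbs + 1)) : A q :=
  if 0 ≤ n then
    ((Real.sqrt (beta q n.natAbs μ) : ℝ) : ℂ) •
      (star (gc q) ^ (μ : ℕ) * star (ga q) ^ (n.natAbs - μ))
  else
    ((Real.sqrt (alpha q n.natAbs μ) : ℝ) : ℂ) •
      (gc q ^ (n.natAbs - μ) * ga q ^ (μ : ℕ))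

variable {q}

theorem beta_eq (n μ : ℕ) : ((beta q n μ : ℝ) : ℂ) = gauss (qC q ^ 2) (qC q ^ (-2 : ℤ)) n μ := by
  simp only [beta, gauss, qC, zpow_mul]
  push_cast
  rw [pow_mul]

theorem alpha_eq (n μ : ℕ) : ((alpha q n μ : ℝ) : ℂ) = gauss 1 (qC q ^ (2 : ℤ)) n (n - μ) := by
  simp only [alpha, gauss, qC, zpow_mul]
  push_cast
  simp

theorem beta_nonneg {n μ : ℕ} (h : μ ≤ n) : 0 ≤ beta q n μ := by
  have h0 := q.2.1
  refine mul_nonneg (pow_nonneg h0.le _) (Finset.prod_nonneg fun j hj => ?_)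
  have hj' := Finset.mem_range.1 hj
  apply div_nonneg_of_nonpos
  · have := one_lt_zpow_of_neg₀ h0 q.2.2 (show -2 * ((n : ℤ) - j) < 0 by omega)
    linarith
  · have := one_lt_zpow_of_neg₀ h0 q.2.2 (show -2 * ((j : ℤ) + 1) < 0 by omega)
    linarith

theorem alpha_nonneg {n μ : ℕ} : 0 ≤ alpha q n μ := by
  have h0 := q.2.1
  refine Finset.prod_nonneg fun j hj => ?_
  have hj' := Finset.mem_range.1 hj
  apply div_nonneg
  · have := zpow_lt_one₀ h0 q.2.2 (show 0 < 2 * ((n : ℤ) - j) by omega)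
    linarith
  · have := zpow_lt_one₀ h0 q.2.2 (show 0 < 2 * ((j : ℤ) + 1) by omega)
    linarith

theorem L_smul {n : ℤ} {x : A q} (r : ℂ) (hx : x ∈ L q n) : r • x ∈ L q n :=
  Submodule.smul_mem _ _ hx

theorem L_congr {m n : ℤ} {x : A q} (hx : x ∈ L q m) (h : m = n) : x ∈ L q n := h ▸ hx

theorem ket_mem (n : ℤ) (μ : Fin (n.natAbs + 1)) : ket q n μ ∈ L q n := by
  have hμ := μ.2
  unfold ket
  split_ifs with h
  · refine L_smul _ (L_congr (L_mul (L_pow ?_ _) (L_pow ?_ _)) ?_ (m := μ * 1 +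
      (n.natAbs - μ : ℕ) * 1))
    · simpa using L_cs
    · simpa using L_as
    · omega
  · refine L_smul _ (L_congr (L_mul (L_pow L_c _) (L_pow L_a _)) ?_)
    omega

theorem star_ket_mem (n : ℤ) (μ : Fin (n.natAbs + 1)) : star (ket q n μ) ∈ L q (-n) := by
  have hμ := μ.2
  unfold ket
  split_ifs with h
  · simp only [star_smul, star_mul, star_pow, star_star]
    refine L_smul _ (L_congr (L_mul (L_pow L_a _) (L_pow L_c _)) ?_)
    omega
  · simp only [star_smul, star_mul, star_pow, star_a, star_c]
    refine L_smul _ (L_congr (L_mul (L_pow L_as _) (L_pow L_cs _)) ?_)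
    omega

theorem sqrt_star_smul {r : ℝ} (h : 0 ≤ r) (x y : A q) :
    star (((Real.sqrt r : ℝ) : ℂ) • x) * (((Real.sqrt r : ℝ) : ℂ) • y) =
      (r : ℂ) • (star x * y) := by
  rw [star_smul, smul_mul_smul_comm]
  congr 1
  rw [show star ((Real.sqrt r : ℝ) : ℂ) = ((Real.sqrt r : ℝ) : ℂ) from Complex.conj_ofReal _,
    ← Complex.ofReal_mul, Real.mul_self_sqrt h]

theorem one_sub_zpow_ne {k : ℤ} (hk : k ≠ 0) : 1 - qC q ^ k ≠ 0 := by
  intro h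
  have h1 : (q : ℝ) ^ k = 1 := by
    have : (((q : ℝ) ^ k : ℝ) : ℂ) = ((1 : ℝ) : ℂ) := by
      simpa [qC] using (sub_eq_zero.1 h).symm
    exact_mod_cast this
  exact hk ((zpow_eq_one_iff_right₀ q.2.1.le q.2.2.ne).1 h1)

/-- `⟨Ψ^(n)|Ψ^(n)⟩ = 1`. -/
theorem star_ket_mul_ket (n : ℤ) : ∑ μ, star (ket q n μ) * ket q n μ = 1 := by
  have hq := qC_ne q
  have hcomm : Commute (gc q) (gcs q) := r5.symm
  by_cases h : 0 ≤ n
  · have e : ∀ μ : Fin (n.natAbs + 1), star (ket q n μ) * ket q n μ =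
        gauss (qC q ^ 2) (qC q ^ (-2 : ℤ)) n.natAbs μ •
          (ga q ^ (n.natAbs - μ) * (gc q * gcs q) ^ (μ : ℕ) * gas q ^ (n.natAbs - μ)) := by
      intro μ
      simp only [ket, if_pos h]
      rw [sqrt_star_smul (beta_nonneg (Nat.lt_succ_iff.1 μ.2)), beta_eq]
      simp only [star_mul, star_pow, star_as, star_cs, star_a, star_c, hcomm.mul_pow, mul_assoc]
    rw [Finset.sum_congr rfl fun μ _ => e μ,
      Fin.sum_univ_eq_sum_range (fun μ => gauss (qC q ^ 2) (qC q ^ (-2 : ℤ)) n.natAbs μ •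
          (ga q ^ (n.natAbs - μ) * (gc q * gcs q) ^ (μ : ℕ) * gas q ^ (n.natAbs - μ)))]
    refine gauss_sum (r := qC q ^ 2) ?_ ?_ ?_ r7 _
    · rw [← zpow_natCast, ← zpow_add₀ hq]; simp
    · intro i
      rw [← zpow_mul]
      exact one_sub_zpow_ne (by omega)
    · rw [← mul_assoc, r1, smul_mul_assoc, mul_assoc, r2, mul_smul_comm, smul_smul, ← mul_assoc,
        sq]
  · have e : ∀ μ : Fin (n.natAbs + 1), star (ket q n μ) * ket q n μ =
        gauss 1 (qC q ^ (2 : ℤ)) n.natAbs (n.natAbs - μ) •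
          (gas q ^ (n.natAbs - (n.natAbs - μ)) * (gc q * gcs q) ^ (n.natAbs - μ) *
            ga q ^ (n.natAbs - (n.natAbs - μ))) := by
      intro μ
      have hμ : n.natAbs - (n.natAbs - (μ : ℕ)) = μ := by have := μ.2; omega
      simp only [ket, if_neg h]
      rw [sqrt_star_smul alpha_nonneg, alpha_eq, hμ, ← r5]
      simp only [star_mul, star_pow, star_a, star_c, hcomm.symm.mul_pow, mul_assoc]
    rw [Finset.sum_congr rfl fun μ _ => e μ,
      Fin.sum_univ_eq_sum_range (fun μ => gauss 1 (qC q ^ (2 : ℤ)) n.natAbs (n.natAbs - μ) •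
          (gas q ^ (n.natAbs - (n.natAbs - μ)) * (gc q * gcs q) ^ (n.natAbs - μ) *
            ga q ^ (n.natAbs - (n.natAbs - μ))))]
    have := Finset.sum_range_reflect (fun j => gauss 1 (qC q ^ (2 : ℤ)) n.natAbs j •
          (gas q ^ (n.natAbs - j) * (gc q * gcs q) ^ j * ga q ^ (n.natAbs - j))) (n.natAbs + 1)
    simp only [Nat.add_sub_cancel] at this
    rw [this]
    refine gauss_sum (r := qC q ^ (-2 : ℤ)) ?_ ?_ ?_ (by rw [r6, one_smul]) _
    · rw [← zpow_add₀ hq]; simp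
    · intro i
      rw [← zpow_mul]
      exact one_sub_zpow_ne (by omega)
    · rw [← mul_assoc, r4, smul_mul_assoc, mul_assoc, r3, mul_smul_comm, smul_smul, ← mul_assoc]
      congr 1
      rw [zpow_neg, ← mul_inv, ← sq]; rfl

theorem mul_mem_Sphere {n : ℤ} {x y : A q} (hx : x ∈ L q n) (hy : y ∈ L q (-n)) :
    x * y ∈ Sphere q :=
  mem_Sphere_iff.2 (L_congr (L_mul hx hy) (add_neg_cancel n))

variable (q)

/-- The projection `p^(n) = |Ψ^(n)⟩⟨Ψ^(n)|`, a matrix with entries in `A(S_q²)`. -/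
def projMatrix (n : ℤ) : Matrix (Fin (n.natAbs + 1)) (Fin (n.natAbs + 1)) (Sphere q) :=
  Matrix.of fun μ ν => ⟨ket q n μ * star (ket q n ν), mul_mem_Sphere (ket_mem n μ) (star_ket_mem n ν)⟩

/-- The left `A(S_q²)`-module `E_n = A(S_q²)^(|n|+1) p^(n)` of row vectors. -/
def SecMod (n : ℤ) : Submodule (Sphere q) (Fin (n.natAbs + 1) → Sphere q) :=
  LinearMap.range (projMatrix q n).vecMulLinear

instance (n : ℤ) : Module (Sphere q) (SecMod q n) := Submodule.module _
instance (n : ℤ) : SMul (Sphere q) (SecMod q n) := Module.toDistribMulAction.toSMul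
instance (n : ℤ) : Module ℂ (SecMod q n) := Submodule.module' _
instance (n : ℤ) : IsScalarTower ℂ (Sphere q) (SecMod q n) :=
  ⟨fun _ _ _ => Subtype.ext (smul_assoc _ _ _)⟩

variable {q}

/-- `E_n` is the set of the rows `σ` with `σ p^(n) = σ`. -/
theorem mem_SecMod {n : ℤ} {σ : Fin (n.natAbs + 1) → Sphere q} :
    σ ∈ SecMod q n ↔ ∀ ν, (∑ μ, (σ μ : A q) * ket q n μ) * star (ket q n ν) = σ ν := by
  have key (f : Fin (n.natAbs + 1) → Sphere q) (ν) : ((Matrix.vecMul f (projMatrix q n) ν :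
      Sphere q) : A q) = (∑ μ, (f μ : A q) * ket q n μ) * star (ket q n ν) := by
    simp [Matrix.vecMul, dotProduct, projMatrix, Finset.sum_mul, mul_assoc]
  constructor
  · rintro ⟨f, rfl⟩ ν
    simp only [Matrix.vecMulLinear_apply, key]
    simp only [mul_assoc, ← Finset.mul_sum, star_ket_mul_ket, mul_one]
  · intro h
    refine ⟨σ, funext fun ν => Subtype.ext ?_⟩
    rw [Matrix.vecMulLinear_apply, key, h]

variable (q) in
/-- The isomorphism `L_n ≃ E_n`, `φ ↦ σ_φ = φ ⟨Ψ^(n)|`, with inverse `σ ↦ ⟨σ|Ψ^(n)⟩`. -/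
def secEquiv (n : ℤ) : L q n ≃ₗ[Sphere q] SecMod q n where
  toFun φ := ⟨fun μ => ⟨φ * star (ket q n μ), mul_mem_Sphere φ.2 (star_ket_mem n μ)⟩,
    mem_SecMod.2 fun ν => by
      simp only [mul_assoc, ← Finset.mul_sum, star_ket_mul_ket, mul_one]⟩
  map_add' φ ψ := by ext; simp [add_mul]
  map_smul' f φ := by ext; simp [mul_assoc]
  invFun σ := ⟨∑ μ, (σ.1 μ : A q) * ket q n μ, Submodule.sum_mem _ fun μ _ =>
    L_congr (L_mul (coe_L _) (ket_mem n μ)) (zero_add n)⟩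
  left_inv φ := by
    ext
    simp only [mul_assoc, ← Finset.mul_sum, star_ket_mul_ket, mul_one]
  right_inv σ := by
    ext ν
    exact mem_SecMod.1 σ.2 ν

variable (q) in
/-- The rows of `p^(n)`, as elements of `E_n`. -/
def projRow (n : ℤ) (ν : Fin (n.natAbs + 1)) : SecMod q n :=
  ⟨projMatrix q n ν, ⟨Pi.single ν 1, by simp [Matrix.row]⟩⟩

theorem sum_smul_projRow {n : ℤ} (σ : SecMod q n) : ∑ ν, σ.1 ν • projRow q n ν = σ := by
  ext μ
  rw [← mem_SecMod.1 σ.2 μ]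
  simp [projRow, projMatrix, Finset.sum_mul, mul_assoc]

variable (q) in
/-- The Grassmann connection `∇σ = (dσ) p^(n) = ∑_ν dσ_ν ⊗ e_ν p^(n)` on `E_n`. -/
def grassmannConnection (n : ℤ) : Connection q (SecMod q n) where
  nabla :=
    { toFun := fun σ => ∑ ν, BTensor.tmul (Sphere q) (d0 q (σ.1 ν)) (projRow q n ν)
      map_add' := fun σ τ => by simp [Finset.sum_add_distrib]
      map_smul' := fun r σ => by simp [Finset.smul_sum] }
  leibniz f σ := by
    simp only [LinearMap.coe_mk, AddHom.coe_mk, Submodule.coe_smul, Pi.smul_apply, smul_eq_mul,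
      d0_mul, map_add, LinearMap.add_apply, Finset.sum_add_distrib, map_sum, BTensor.lsmul_tmul,
      BTensor.tmul_smul]
    refine (add_comm _ _).trans (congrArg _ ?_)
    exact (map_sum _ _ _).symm.trans (congrArg _ (sum_smul_projRow σ))

/-! The monopole connection -/

variable (q) in
/-- The multiplication map `Ω¹(S_q²) ⊗ L_n → L_{n-2} ω₋ ⊕ L_{n+2} ω₊`, `α ⊗ φ ↦ α φ`, with
`ω_± φ = (K² ▷ φ) ω_±`. -/
def horMul (n : ℤ) : BTensor (Sphere q) (Form1 q) (L q n) →ₗ[ℂ] L q (n - 2) × L q (n + 2) :=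
  BTensor.lift
    (LinearMap.mk₂ ℂ
      (fun α φ => (⟨α.1 * act q (uK q ^ 2) φ, by
          rw [K2_L φ.2, mul_smul_comm]
          exact L_smul _ (L_congr (L_mul α.1.2 φ.2) (by ring))⟩,
        ⟨α.2 * act q (uK q ^ 2) φ, by
          rw [K2_L φ.2, mul_smul_comm]
          exact L_smul _ (L_congr (L_mul α.2.2 φ.2) (by ring))⟩))
      (fun α β φ => by ext <;> simp [add_mul])
      (fun r α φ => by ext <;> simp)
      (fun α φ ψ => by ext <;> simp [mul_add])
      (fun r α φ => by ext <;> simp))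
    (fun α b φ => by
      have h : (opK q ^ 2) (b : A q) = b := by simpa using K2_L (coe_L b)
      ext <;> simp [mul_assoc, sq, opK_mul] at h ⊢ <;> simp [h])

theorem horMul_tmul (n : ℤ) (α : Form1 q) (φ : L q n) :
    ((horMul q n (BTensor.tmul (Sphere q) α φ)).1 : A q) = qC q ^ n • ((α.1 : A q) * φ) ∧
    ((horMul q n (BTensor.tmul (Sphere q) α φ)).2 : A q) = qC q ^ n • ((α.2 : A q) * φ) := by
  have h : (opK q ^ 2) (φ : A q) = qC q ^ n • (φ : A q) := by simpa using K2_L φ.2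
  simp [horMul, h]

theorem ket_unity (n : ℤ) (w : A q) : ∑ μ, star (ket q n μ) * (ket q n μ * w) = w := by
  simp only [← mul_assoc]
  rw [← Finset.sum_mul, star_ket_mul_ket, one_mul]

/-- The inverse of the multiplication map, built from a partition of unity. -/
def horInv (q : Set.Ioo (0 : ℝ) 1) (n : ℤ) :
    L q (n - 2) × L q (n + 2) →ₗ[ℂ] BTensor (Sphere q) (Form1 q) (L q n) where
  toFun z := qC q ^ (-n) •
    ((∑ μ, BTensor.tmul (Sphere q) ((⟨star (ket q 2 μ), star_ket_mem 2 μ⟩, 0) : Form1 q)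
      (⟨ket q 2 μ * z.1, L_congr (L_mul (ket_mem 2 μ) z.1.2) (by ring)⟩ : L q n)) +
    ∑ μ, BTensor.tmul (Sphere q) ((0, ⟨star (ket q (-2) μ), star_ket_mem (-2) μ⟩) : Form1 q)
      (⟨ket q (-2) μ * z.2, L_congr (L_mul (ket_mem (-2) μ) z.2.2) (by ring)⟩ : L q n))
  map_add' z w := by
    have e1 (μ) : (⟨ket q 2 μ * (z + w).1, L_congr (L_mul (ket_mem 2 μ) (z + w).1.2) (by ring)⟩ :
        L q n) = ⟨ket q 2 μ * z.1, L_congr (L_mul (ket_mem 2 μ) z.1.2) (by ring)⟩ +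
        ⟨ket q 2 μ * w.1, L_congr (L_mul (ket_mem 2 μ) w.1.2) (by ring)⟩ := by
      ext; simp [mul_add]
    have e2 (μ) : (⟨ket q (-2) μ * (z + w).2, L_congr (L_mul (ket_mem (-2) μ) (z + w).2.2)
        (by ring)⟩ : L q n) =
        ⟨ket q (-2) μ * z.2, L_congr (L_mul (ket_mem (-2) μ) z.2.2) (by ring)⟩ +
        ⟨ket q (-2) μ * w.2, L_congr (L_mul (ket_mem (-2) μ) w.2.2) (by ring)⟩ := by
      ext; simp [mul_add]
    simp only [e1, e2, map_add, Finset.sum_add_distrib, smul_add]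
    abel
  map_smul' r z := by
    have e1 (μ) : (⟨ket q 2 μ * (r • z).1, L_congr (L_mul (ket_mem 2 μ) (r • z).1.2) (by ring)⟩ :
        L q n) = r • ⟨ket q 2 μ * z.1, L_congr (L_mul (ket_mem 2 μ) z.1.2) (by ring)⟩ := by
      ext; simp
    have e2 (μ) : (⟨ket q (-2) μ * (r • z).2, L_congr (L_mul (ket_mem (-2) μ) (r • z).2.2)
        (by ring)⟩ : L q n) =
        r • ⟨ket q (-2) μ * z.2, L_congr (L_mul (ket_mem (-2) μ) z.2.2) (by ring)⟩ := by
      ext; simp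
    simp only [e1, e2, map_smul, ← Finset.smul_sum, ← smul_add, RingHom.id_apply]
    rw [smul_comm]

theorem horInv_horMul (n : ℤ) (t : BTensor (Sphere q) (Form1 q) (L q n)) :
    horInv q n (horMul q n t) = t := by
  have hq := qC_ne q
  have : (horInv q n).comp (horMul q n) = LinearMap.id := by
    apply BTensor.ext
    rintro ⟨x, y⟩ φ
    obtain ⟨h1, h2⟩ := horMul_tmul n (x, y) φ
    have e1 (μ) : (⟨ket q 2 μ * (horMul q n (BTensor.tmul (Sphere q) (x, y) φ)).1,
        L_congr (L_mul (ket_mem 2 μ) (horMul q n (BTensor.tmul (Sphere q) (x, y) φ)).1.2)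
          (by ring)⟩ : L q n) =
        qC q ^ n • (⟨ket q 2 μ * x, mul_mem_Sphere (ket_mem 2 μ) x.2⟩ : Sphere q) • φ := by
      ext; simp [h1, mul_assoc]
    have e2 (μ) : (⟨ket q (-2) μ * (horMul q n (BTensor.tmul (Sphere q) (x, y) φ)).2,
        L_congr (L_mul (ket_mem (-2) μ) (horMul q n (BTensor.tmul (Sphere q) (x, y) φ)).2.2)
          (by ring)⟩ : L q n) =
        qC q ^ n • (⟨ket q (-2) μ * y, mul_mem_Sphere (ket_mem (-2) μ) y.2⟩ : Sphere q) • φ := by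
      ext; simp [h2, mul_assoc]
    simp only [LinearMap.comp_apply, horInv, LinearMap.coe_mk, AddHom.coe_mk, e1, e2, map_smul,
      ← BTensor.tmul_smul, LinearMap.id_apply, ← Finset.smul_sum, ← smul_add, smul_smul,
      ← LinearMap.sum_apply, ← map_sum, ← LinearMap.add_apply, ← map_add]
    rw [← zpow_add₀ hq, neg_add_cancel, zpow_zero, one_smul]
    congr 2
    ext
    · simp only [Prod.fst_add, Prod.fst_sum, Prod.smul_fst, smul_zero, Finset.sum_const_zero,
        add_zero, Submodule.coe_sum, coe_op_smul_L, MulOpposite.unop_op]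
      exact ket_unity 2 _
    · simp only [Prod.snd_add, Prod.snd_sum, Prod.smul_snd, smul_zero, Finset.sum_const_zero,
        zero_add, Submodule.coe_sum, coe_op_smul_L, MulOpposite.unop_op]
      exact ket_unity (-2) _
  exact congrArg (fun f => f t) this

theorem horMul_horInv (n : ℤ) (z : L q (n - 2) × L q (n + 2)) :
    horMul q n (horInv q n z) = z := by
  have hq := qC_ne q
  have hs : qC q ^ (-n) * qC q ^ n = 1 := by rw [← zpow_add₀ hq, neg_add_cancel, zpow_zero]
  ext
  · simp only [horInv, LinearMap.coe_mk, AddHom.coe_mk, map_smul, map_add, map_sum, Prod.smul_fst,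
      Prod.fst_add, Prod.fst_sum, Submodule.coe_smul, Submodule.coe_add, Submodule.coe_sum,
      (horMul_tmul n _ _).1, ← Finset.smul_sum, ← smul_add, smul_smul, hs]
    simpa using ket_unity 2 (z.1 : A q)
  · simp only [horInv, LinearMap.coe_mk, AddHom.coe_mk, map_smul, map_add, map_sum, Prod.smul_snd,
      Prod.snd_add, Prod.snd_sum, Submodule.coe_smul, Submodule.coe_add, Submodule.coe_sum,
      (horMul_tmul n _ _).2, ← Finset.smul_sum, ← smul_add, smul_smul, hs]
    simpa using ket_unity (-2) (z.2 : A q)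

variable (q)

/-- The isomorphism `Ω¹(S_q²) ⊗ L_n ≃ L_{n-2} ω₋ ⊕ L_{n+2} ω₊` given by multiplication. -/
def horEquiv (n : ℤ) :
    BTensor (Sphere q) (Form1 q) (L q n) ≃ₗ[ℂ] L q (n - 2) × L q (n + 2) :=
  LinearEquiv.ofLinearMap (horMul q n) (horInv q n)
    (LinearMap.ext (horMul_horInv n)) (LinearMap.ext (horInv_horMul n))

/-- One-forms on `SU_q(2)`: the free left module with basis `ω₋`, `ω₊`, `ω_z`. -/
abbrev FormSU : Type := A q × A q × A q

/-- The differential of the three-dimensional calculus on `SU_q(2)`,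
`f ↦ (X₋ ▷ f) ω₋ + (X₊ ▷ f) ω₊ + (X_z ▷ f) ω_z`. -/
def dSU : A q →ₗ[ℂ] FormSU q :=
  (act q (Xm q)).prod ((act q (Xp q)).prod (act q (Xz q)))

/-- The projection onto vertical forms, `ω_z ↦ ω_z`, `ω_± ↦ 0`. -/
def vertProj : FormSU q →ₗ[A q] FormSU q where
  toFun α := (0, 0, α.2.2)
  map_add' α β := by simp
  map_smul' x α := by simp

/-- The horizontal part `(id - Π_z) dφ = (X₋ ▷ φ) ω₋ + (X₊ ▷ φ) ω₊` for `φ` in `L_n`. -/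
def horDiff (n : ℤ) : L q n →ₗ[ℂ] L q (n - 2) × L q (n + 2) where
  toFun φ := (⟨(dSU q φ - vertProj q (dSU q φ)).1, by
      simpa [dSU, vertProj] using Xm_mem φ.2⟩,
    ⟨(dSU q φ - vertProj q (dSU q φ)).2.1, by
      simpa [dSU, vertProj] using Xp_mem φ.2⟩)
  map_add' φ ψ := by ext <;> simp [dSU, vertProj]
  map_smul' r φ := by ext <;> simp [dSU, vertProj]

variable {q} in
theorem horDiff_apply {n : ℤ} (φ : L q n) :
    ((horDiff q n φ).1 : A q) = act q (Xm q) φ ∧ ((horDiff q n φ).2 : A q) = act q (Xp q) φ := by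
  simp [horDiff, dSU, vertProj]

variable {q} in
theorem horMul_lsmul (n : ℤ) (f : Sphere q) (t : BTensor (Sphere q) (Form1 q) (L q n)) :
    horMul q n (BTensor.lsmul f t) = f • horMul q n t := by
  have : (horMul q n).comp (BTensor.lsmul f) =
      (DistribSMul.toLinearMap ℂ (L q (n - 2) × L q (n + 2)) f).comp (horMul q n) := by
    apply BTensor.ext
    intro α φ
    ext <;> simp [horMul, mul_assoc]
  exact congrArg (fun g => g t) this

/-- The monopole connection on `L_n`: `∇φ` is the element of `Ω¹(S_q²) ⊗ L_n` corresponding to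
`(id - Π_z) dφ` under multiplication. -/
def monopoleConnection (n : ℤ) : Connection q (L q n) where
  nabla := (horEquiv q n).symm.toLinearMap ∘ₗ horDiff q n
  leibniz f φ := by
    apply (horEquiv q n).injective
    have e (t) : horEquiv q n t = horMul q n t := rfl
    have h : (opK q ^ 2) (φ : A q) = qC q ^ n • (φ : A q) := by simpa using K2_L φ.2
    have e' (z) : horMul q n ((horEquiv q n).symm z) = z := (horEquiv q n).apply_symm_apply z
    rw [map_add]
    simp only [e, LinearMap.comp_apply, LinearEquiv.coe_coe, e', horMul_lsmul]
    obtain ⟨h1, h2⟩ := horMul_tmul n (d0 q f) φ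
    ext
    · rw [(horDiff_apply _).1, Prod.fst_add, Submodule.coe_add, h1]
      simp [(horDiff_apply φ).1, Xm_mul, h, d0]
    · rw [(horDiff_apply _).2, Prod.snd_add, Submodule.coe_add, h2]
      simp [(horDiff_apply φ).2, Xp_mul, h, d0]

end QHopf

open QHopf

/-!
The two assertions rest on the twisted Leibniz rule
`X_± ▷ (x y) = x (X_± ▷ y) + (X_± ▷ x) (K² ▷ y)`, in which `K²` acts on `L_n` as `q^n`.

For the monopole connection, identify `Ω¹(S_q²) ⊗ L_n` with `L_{n-2} ω₋ ⊕ L_{n+2} ω₊` by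
multiplication.  The two terms of `∇(α ⊗ φ) = dα ⊗ φ - α ∧ ∇φ` are then the two terms of a twisted
Leibniz rule, so that `⋆∇` becomes `(x, y) ↦ q^(-2n) (X₊ ▷ x - q⁻² X₋ ▷ y)`
(`hodgeT2_nabla1_monopole`).  Inserting `⋆∇φ = (-X₋ ▷ φ, X₊ ▷ φ)` gives the formula for the
gauged Laplacian (`gaugedLaplacian_monopole`).

The gauged Laplacian is natural: a module map which intertwines two connections intertwines their
Laplacians (`gaugedLaplacian_naturality`).  The map `φ ↦ σ_φ` intertwines the monopole connection
with the Grassmann connection (`grassmannConnection_secEquiv`), because under multiplication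
`∑_ν d(φ ψ_ν*) ⊗ ψ_ν` differs from `(X₋ ▷ φ) ω₋ + (X₊ ▷ φ) ω₊` by a multiple of
`φ ∑_ν (X_± ▷ ψ_ν*) ψ_ν`.  This last sum vanishes (`sum_act_star_ket_mul_ket`): one of `X_± ▷ ψ_ν` and
`X_± ▷ ψ_ν*` is zero, as `E` annihilates the words in `a*, c*` and `F` those in `a, c`, and by the
Leibniz rule for `∑_ν ψ_ν* ψ_ν = 1` the two alternatives give the same conclusion.
-/

namespace QHopf

/-! ### Naturality of the gauged Laplacian -/

section mapRight

variable {B M N N' : Type} [Ring B] [AddCommGroup M] [Module ℂ M] [Module Bᵐᵒᵖ M]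
  [AddCommGroup N] [Module ℂ N] [Module B N] [AddCommGroup N'] [Module ℂ N'] [Module B N']

/-- The map `id ⊗ g` on `M ⊗_B N` induced by a left `B`-linear map `g`. -/
def BTensor.mapRight (g : N →ₗ[ℂ] N') (hg : ∀ (b : B) (n : N), g (b • n) = b • g n) :
    BTensor B M N →ₗ[ℂ] BTensor B M N' :=
  BTensor.lift ((BTensor.tmul B).compl₂ g) fun m b n => by simp [hg, BTensor.tmul_smul]

@[simp] theorem BTensor.mapRight_tmul (g : N →ₗ[ℂ] N')
    (hg : ∀ (b : B) (n : N), g (b • n) = b • g n) (m : M) (n : N) :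
    BTensor.mapRight g hg (BTensor.tmul B m n) = BTensor.tmul B m (g n) := by
  simp [BTensor.mapRight]

end mapRight

variable {q : Set.Ioo (0 : ℝ) 1}

section naturality

variable {E E' : Type} [AddCommGroup E] [Module ℂ E] [Module (Sphere q) E]
  [AddCommGroup E'] [Module ℂ E'] [Module (Sphere q) E']
  (g : E →ₗ[ℂ] E') (hg : ∀ (b : Sphere q) (φ : E), g (b • φ) = b • g φ)

theorem wedgeT_mapRight (α : Form1 q) (t : BTensor (Sphere q) (Form1 q) E) :
    wedgeT α (BTensor.mapRight g hg t) = BTensor.mapRight g hg (wedgeT α t) := by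
  have : (wedgeT α).comp (BTensor.mapRight g hg) = (BTensor.mapRight g hg).comp (wedgeT α) := by
    apply BTensor.ext
    intro β φ
    simp
  exact congrArg (fun f => f t) this

theorem hodgeT1_mapRight (t : BTensor (Sphere q) (Form1 q) E) :
    hodgeT1 (BTensor.mapRight g hg t) = BTensor.mapRight g hg (hodgeT1 t) := by
  have : hodgeT1.comp (BTensor.mapRight g hg) = (BTensor.mapRight g hg).comp hodgeT1 := by
    apply BTensor.ext
    intro β φ
    simp [hodgeT1]
  exact congrArg (fun f => f t) this

theorem hodgeT2_tmul [IsScalarTower ℂ (Sphere q) E] (f : Form2 q) (φ : E) :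
    hodgeT2 (BTensor.tmul (Sphere q) f φ) = hodge2 q f • φ :=
  BTensor.lift_tmul _ _ f φ

theorem hodgeT2_mapRight [IsScalarTower ℂ (Sphere q) E] [IsScalarTower ℂ (Sphere q) E']
    (t : BTensor (Sphere q) (Form2 q) E) :
    hodgeT2 (BTensor.mapRight g hg t) = g (hodgeT2 t) := by
  have : hodgeT2.comp (BTensor.mapRight g hg) = g.comp hodgeT2 := by
    apply BTensor.ext
    intro β φ
    simp [hodgeT2_tmul, hg]
  exact congrArg (fun f => f t) this

theorem Connection.nabla1_tmul (D : Connection q E) (α : Form1 q) (φ : E) :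
    D.nabla1 (BTensor.tmul (Sphere q) α φ) =
      BTensor.tmul (Sphere q) (d1 q α) φ - wedgeT α (D.nabla φ) := by
  simp [Connection.nabla1]

theorem nabla1_mapRight {D : Connection q E} {D' : Connection q E'}
    (h : ∀ φ, D'.nabla (g φ) = BTensor.mapRight g hg (D.nabla φ))
    (t : BTensor (Sphere q) (Form1 q) E) :
    D'.nabla1 (BTensor.mapRight g hg t) = BTensor.mapRight g hg (D.nabla1 t) := by
  have : D'.nabla1.comp (BTensor.mapRight g hg) = (BTensor.mapRight g hg).comp D.nabla1 := by
    apply BTensor.ext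
    intro β φ
    simp [Connection.nabla1_tmul, h, wedgeT_mapRight]
  exact congrArg (fun f => f t) this

/-- A module map which intertwines two connections intertwines their gauged Laplacians. -/
theorem gaugedLaplacian_naturality [IsScalarTower ℂ (Sphere q) E] [IsScalarTower ℂ (Sphere q) E']
    {D : Connection q E} {D' : Connection q E'}
    (h : ∀ φ, D'.nabla (g φ) = BTensor.mapRight g hg (D.nabla φ)) (φ : E) :
    gaugedLaplacian D' (g φ) = g (gaugedLaplacian D φ) := by
  simp only [gaugedLaplacian, LinearMap.smul_apply, LinearMap.comp_apply, map_smul, h,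
    hodgeT1_mapRight, nabla1_mapRight g hg h, hodgeT2_mapRight]

end naturality

/-! ### The Laplacian of the monopole connection -/

theorem horMul_nabla_monopole {n : ℤ} (φ : L q n) :
    horMul q n ((monopoleConnection q n).nabla φ) = horDiff q n φ :=
  (horEquiv q n).apply_symm_apply _

theorem Xp_mul_L {n : ℤ} (x : A q) (φ : L q n) :
    act q (Xp q) (x * φ) = x * act q (Xp q) φ + qC q ^ n • (act q (Xp q) x * φ) := by
  rw [Xp_mul, K2_L φ.2, mul_smul_comm]

theorem Xm_mul_L {n : ℤ} (x : A q) (φ : L q n) :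
    act q (Xm q) (x * φ) = x * act q (Xm q) φ + qC q ^ n • (act q (Xm q) x * φ) := by
  rw [Xm_mul, K2_L φ.2, mul_smul_comm]

/-- The map `⋆(α ∧ ·)` on `Ω¹(S_q²) ⊗ L_n`, read through the multiplication map. -/
theorem hodgeT2_wedgeT {n : ℤ} (α : Form1 q) (t : BTensor (Sphere q) (Form1 q) (L q n)) :
    ((hodgeT2 (wedgeT α t) : L q n) : A q) =
      qC q ^ (-n) • (qC q ^ (-2 : ℤ) • ((α.2 : A q) * (horMul q n t).1) -
        (α.1 : A q) * (horMul q n t).2) := by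
  have hs : qC q ^ (-n) * qC q ^ n = 1 := by
    rw [← zpow_add₀ (qC_ne q), neg_add_cancel, zpow_zero]
  have : (L q n).subtype ∘ₗ hodgeT2 ∘ₗ wedgeT α =
      qC q ^ (-n) • (qC q ^ (-2 : ℤ) • (LinearMap.mulLeft ℂ (α.2 : A q) ∘ₗ
          (L q (n - 2)).subtype ∘ₗ LinearMap.fst ℂ _ _ ∘ₗ horMul q n) -
        LinearMap.mulLeft ℂ (α.1 : A q) ∘ₗ
          (L q (n + 2)).subtype ∘ₗ LinearMap.snd ℂ _ _ ∘ₗ horMul q n) := by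
    apply BTensor.ext
    intro β φ
    obtain ⟨h1, h2⟩ := horMul_tmul n β φ
    simp only [LinearMap.comp_apply, LinearMap.smul_apply, LinearMap.sub_apply, wedgeT_tmul,
      hodgeT2_tmul, LinearMap.fst_apply, LinearMap.snd_apply, Submodule.subtype_apply,
      LinearMap.mulLeft_apply, h1, h2, mul_smul_comm]
    rw [smul_comm (qC q ^ (-2 : ℤ)) (qC q ^ n), ← smul_sub, smul_smul, hs, one_smul]
    simp [hodge2, wedge, sub_mul, mul_assoc]
  exact congrArg (fun f => f t) this

/-- Under the multiplication map, `⋆∇` on `L_n`-valued one-forms is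
`(x, y) ↦ q^(-2n) (X₊ ▷ x - q⁻² X₋ ▷ y)`. -/
theorem hodgeT2_nabla1_monopole {n : ℤ} (t : BTensor (Sphere q) (Form1 q) (L q n)) :
    ((hodgeT2 ((monopoleConnection q n).nabla1 t) : L q n) : A q) =
      qC q ^ (-2 * n) • (act q (Xp q) (horMul q n t).1 -
        qC q ^ (-2 : ℤ) • act q (Xm q) (horMul q n t).2) := by
  have hq := qC_ne q
  have hs : qC q ^ (-n) * qC q ^ n = 1 := by rw [← zpow_add₀ hq, neg_add_cancel, zpow_zero]
  have hs2 : qC q ^ (-2 * n) * qC q ^ n = qC q ^ (-n) := by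
    rw [← zpow_add₀ hq]; congr 1; ring
  have : (L q n).subtype ∘ₗ hodgeT2 ∘ₗ (monopoleConnection q n).nabla1 =
      qC q ^ (-2 * n) • (act q (Xp q) ∘ₗ
          (L q (n - 2)).subtype ∘ₗ LinearMap.fst ℂ _ _ ∘ₗ horMul q n -
        qC q ^ (-2 : ℤ) • (act q (Xm q) ∘ₗ
          (L q (n + 2)).subtype ∘ₗ LinearMap.snd ℂ _ _ ∘ₗ horMul q n)) := by
    apply BTensor.ext
    intro α φ
    obtain ⟨h1, h2⟩ := horMul_tmul n α φ
    obtain ⟨h3, h4⟩ := horDiff_apply φ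
    have e : ((hodgeT2 (BTensor.tmul (Sphere q) (d1 q α) φ) : L q n) : A q) =
        act q (Xp q) α.1 * φ - qC q ^ (-2 : ℤ) • (act q (Xm q) α.2 * φ) := by
      simp [hodgeT2_tmul, hodge2, d1, sub_mul]
    simp only [LinearMap.comp_apply, LinearMap.smul_apply, LinearMap.sub_apply,
      LinearMap.fst_apply, LinearMap.snd_apply, Submodule.subtype_apply, h1, h2,
      Connection.nabla1_tmul, map_sub, e, hodgeT2_wedgeT,
      horMul_nabla_monopole, h3, h4, map_smul, Xp_mul_L, Xm_mul_L]
    rw [smul_comm (qC q ^ (-2 : ℤ)) (qC q ^ n), ← smul_sub, smul_smul, hs2]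
    simp only [smul_add, smul_sub, smul_smul, hs, one_smul]
    rw [mul_left_comm, hs, mul_one]
    abel
  exact congrArg (fun f => f t) this

theorem horMul_hodgeT1 {n : ℤ} (t : BTensor (Sphere q) (Form1 q) (L q n)) :
    horMul q n (hodgeT1 t) = (-(horMul q n t).1, (horMul q n t).2) := by
  have : horMul q n ∘ₗ hodgeT1 =
      LinearMap.prodMap (-LinearMap.id) LinearMap.id ∘ₗ horMul q n := by
    apply BTensor.ext
    intro α φ
    ext <;> simp [hodgeT1, hodge1, horMul]
  exact congrArg (fun f => f t) this

theorem gaugedLaplacian_monopole {n : ℤ} (φ : L q n) :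
    ((gaugedLaplacian (monopoleConnection q n) φ : L q n) : A q) =
      (1 / 2 * qC q ^ (-2 * n)) •
        act q (Xp q * Xm q + qC q ^ (-2 : ℤ) • (Xm q * Xp q)) φ := by
  obtain ⟨h1, h2⟩ := horDiff_apply φ
  simp only [gaugedLaplacian, LinearMap.smul_apply, LinearMap.comp_apply, Submodule.coe_smul,
    hodgeT2_nabla1_monopole, horMul_hodgeT1, horMul_nabla_monopole, Submodule.coe_neg, h1, h2,
    map_neg, map_add, map_mul, map_smul, LinearMap.add_apply, Module.End.mul_apply]
  module

/-! ### The Grassmann connection and the monopole connection -/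

theorem opE_mul_eq_zero {x y : A q} (hx : opE q x = 0) (hy : opE q y = 0) :
    opE q (x * y) = 0 := by
  rw [opE_mul, hx, hy, zero_mul, mul_zero, add_zero]

theorem opF_mul_eq_zero {x y : A q} (hx : opF q x = 0) (hy : opF q y = 0) :
    opF q (x * y) = 0 := by
  rw [opF_mul, hx, hy, zero_mul, mul_zero, add_zero]

theorem opE_pow_eq_zero {x : A q} (hx : opE q x = 0) (k : ℕ) : opE q (x ^ k) = 0 := by
  induction k with
  | zero => simp
  | succ k ih => rw [pow_succ, opE_mul_eq_zero ih hx]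

theorem opF_pow_eq_zero {x : A q} (hx : opF q x = 0) (k : ℕ) : opF q (x ^ k) = 0 := by
  induction k with
  | zero => simp
  | succ k ih => rw [pow_succ, opF_mul_eq_zero ih hx]

theorem Xp_eq_zero {n : ℤ} {x : A q} (hx : x ∈ L q n) (h : opE q x = 0) :
    act q (Xp q) x = 0 := by
  simp [Xp, mem_L.1 hx, h]

theorem Xm_eq_zero {n : ℤ} {x : A q} (hx : x ∈ L q n) (h : opF q x = 0) :
    act q (Xm q) x = 0 := by
  simp [Xm, mem_L.1 hx, h]

theorem Xp_ket {n : ℤ} (hn : 0 ≤ n) (μ) : act q (Xp q) (ket q n μ) = 0 := by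
  refine Xp_eq_zero (ket_mem n μ) ?_
  rw [ket, if_pos hn, map_smul, star_c, star_a,
    opE_mul_eq_zero (opE_pow_eq_zero opE_cs _) (opE_pow_eq_zero opE_as _), smul_zero]

theorem Xm_star_ket {n : ℤ} (hn : 0 ≤ n) (μ) : act q (Xm q) (star (ket q n μ)) = 0 := by
  refine Xm_eq_zero (star_ket_mem n μ) ?_
  rw [ket, if_pos hn, star_smul, star_mul, star_pow, star_pow, star_star, star_star, map_smul,
    opF_mul_eq_zero (opF_pow_eq_zero opF_a _) (opF_pow_eq_zero opF_c _), smul_zero]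

theorem Xm_ket {n : ℤ} (hn : ¬ 0 ≤ n) (μ) : act q (Xm q) (ket q n μ) = 0 := by
  refine Xm_eq_zero (ket_mem n μ) ?_
  rw [ket, if_neg hn, map_smul,
    opF_mul_eq_zero (opF_pow_eq_zero opF_c _) (opF_pow_eq_zero opF_a _), smul_zero]

theorem Xp_star_ket {n : ℤ} (hn : ¬ 0 ≤ n) (μ) : act q (Xp q) (star (ket q n μ)) = 0 := by
  refine Xp_eq_zero (star_ket_mem n μ) ?_
  rw [ket, if_neg hn, star_smul, star_mul, star_pow, star_pow, star_a, star_c, map_smul,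
    opE_mul_eq_zero (opE_pow_eq_zero opE_as _) (opE_pow_eq_zero opE_cs _), smul_zero]

/-- If `X` obeys the twisted Leibniz rule of `X_±` and annihilates the components of `|Ψ^(n)⟩`,
then applying `X` to `∑_ν ψ_ν* ψ_ν = 1` gives `∑_ν (X ▷ ψ_ν*) ψ_ν = 0`. -/
theorem sum_act_star_ket_mul_ket_of_ket {n : ℤ} {X : Module.End ℂ (A q)} (h1 : X 1 = 0)
    (hX : ∀ (x : A q) (φ : L q n), X (x * φ) = x * X φ + qC q ^ n • (X x * φ))
    (h : ∀ μ, X (ket q n μ) = 0) : ∑ μ, X (star (ket q n μ)) * ket q n μ = 0 := by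
  have e : X (∑ μ, star (ket q n μ) * ket q n μ) = 0 := by rw [star_ket_mul_ket, h1]
  have hX' (μ) : X (star (ket q n μ) * ket q n μ) =
      qC q ^ n • (X (star (ket q n μ)) * ket q n μ) := by
    rw [hX (star (ket q n μ)) ⟨ket q n μ, ket_mem n μ⟩, h, mul_zero, zero_add]
  simp only [map_sum, hX', ← Finset.smul_sum] at e
  exact (smul_eq_zero.1 e).resolve_left (zpow_ne_zero _ (qC_ne q))

/-- `∑_ν (X_± ▷ ψ_ν*) ψ_ν = 0`. -/
theorem sum_act_star_ket_mul_ket (n : ℤ) :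
    ∑ μ, act q (Xm q) (star (ket q n μ)) * ket q n μ = 0 ∧
    ∑ μ, act q (Xp q) (star (ket q n μ)) * ket q n μ = 0 := by
  by_cases hn : 0 ≤ n
  · exact ⟨by simp [Xm_star_ket hn],
      sum_act_star_ket_mul_ket_of_ket Xp_one Xp_mul_L (Xp_ket hn)⟩
  · exact ⟨sum_act_star_ket_mul_ket_of_ket Xm_one Xm_mul_L (Xm_ket hn),
      by simp [Xp_star_ket hn]⟩

/-- If `X` obeys the twisted Leibniz rule of `X_±` and `∑_ν (X ▷ ψ_ν*) ψ_ν = 0`, then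
`∑_ν X ▷ (φ ψ_ν*) ψ_ν` is `X ▷ φ` up to the factor by which `K²` acts on `ψ_ν*`. -/
theorem sum_act_mul_star_ket_mul_ket {n : ℤ} {X : Module.End ℂ (A q)}
    (hX : ∀ (x : A q) (ψ : L q (-n)), X (x * ψ) = x * X ψ + qC q ^ (-n) • (X x * ψ))
    (h : ∑ μ, X (star (ket q n μ)) * ket q n μ = 0) (φ : A q) :
    ∑ μ, qC q ^ n • (X (φ * star (ket q n μ)) * ket q n μ) = X φ := by
  have hs : qC q ^ n * qC q ^ (-n) = 1 := by
    rw [← zpow_add₀ (qC_ne q), add_neg_cancel, zpow_zero]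
  have hX' (μ) : X (φ * star (ket q n μ)) =
      φ * X (star (ket q n μ)) + qC q ^ (-n) • (X φ * star (ket q n μ)) :=
    hX φ ⟨star (ket q n μ), star_ket_mem n μ⟩
  simp only [hX', add_mul, mul_assoc, smul_mul_assoc, smul_add, smul_smul, hs, one_smul,
    Finset.sum_add_distrib, ← Finset.smul_sum, ← Finset.mul_sum, h, star_ket_mul_ket, mul_zero,
    smul_zero, zero_add, mul_one]

/-- The monopole connection is `φ ↦ ∑_ν d(φ ψ_ν*) ⊗ ψ_ν`. -/
theorem nabla_monopole_eq_sum {n : ℤ} (φ : L q n) :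
    (monopoleConnection q n).nabla φ =
      ∑ μ, BTensor.tmul (Sphere q)
        (d0 q ⟨φ * star (ket q n μ), mul_mem_Sphere φ.2 (star_ket_mem n μ)⟩)
        (⟨ket q n μ, ket_mem n μ⟩ : L q n) := by
  apply (horEquiv q n).injective
  change horMul q n _ = horMul q n _
  rw [horMul_nabla_monopole, map_sum]
  obtain ⟨h1, h2⟩ := horDiff_apply φ
  obtain ⟨h3, h4⟩ := sum_act_star_ket_mul_ket (q := q) n
  ext
  · simp only [h1, Prod.fst_sum, Submodule.coe_sum, (horMul_tmul n _ _).1]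
    exact (sum_act_mul_star_ket_mul_ket Xm_mul_L h3 _).symm
  · simp only [h2, Prod.snd_sum, Submodule.coe_sum, (horMul_tmul n _ _).2]
    exact (sum_act_mul_star_ket_mul_ket Xp_mul_L h4 _).symm

/-- The isomorphism `φ ↦ σ_φ` intertwines the monopole and the Grassmann connection. -/
theorem grassmannConnection_secEquiv {n : ℤ} (φ : L q n) :
    (grassmannConnection q n).nabla (secEquiv q n φ) =
      BTensor.mapRight ((secEquiv q n).toLinearMap.restrictScalars ℂ) (secEquiv q n).map_smul
        ((monopoleConnection q n).nabla φ) := by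
  rw [nabla_monopole_eq_sum, map_sum]
  change ∑ ν, BTensor.tmul (Sphere q) (d0 q ((secEquiv q n φ).1 ν)) (projRow q n ν) = _
  refine Finset.sum_congr rfl fun ν _ => ?_
  -- The row `e_ν p^(n)` is, by definition, the section of `ψ_ν`.
  exact (BTensor.mapRight_tmul ((secEquiv q n).toLinearMap.restrictScalars ℂ)
    (secEquiv q n).map_smul _ (⟨ket q n ν, ket_mem n ν⟩ : L q n)).symm

end QHopf

theorem mainTheorem3 (q : Set.Ioo (0 : ℝ) 1) (n : ℤ) :
    (∀ φ : L q n, ((gaugedLaplacian (monopoleConnection q n) φ : L q n) : A q) =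
      (1 / 2 * qC q ^ (-2 * n)) •
        act q (Xp q * Xm q + qC q ^ (-2 : ℤ) • (Xm q * Xp q)) φ) ∧
    (∀ φ : L q n, gaugedLaplacian (grassmannConnection q n) (secEquiv q n φ) =
      secEquiv q n (gaugedLaplacian (monopoleConnection q n) φ)) :=
  ⟨gaugedLaplacian_monopole,
    gaugedLaplacian_naturality ((secEquiv q n).toLinearMap.restrictScalars ℂ)
      (secEquiv q n).map_smul grassmannConnection_secEquiv⟩
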